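/- Let $M$ be a $C^\infty$ (Hausdorff, second countable) manifold of dimension $2n$ endowed with an almost biparacomplex structure $(F,P)$, i.e. two smooth tensor fields $F,P$ of type $(1,1)$ with $F^2=P^2=\mathrm{Id}$ and $F\circ P+P\circ F=0$. Let $\nabla$ be its canonical connection, i.e. the unique linear connection on $M$ such that $\nabla F=0=\nabla P$ and $T(X,Y)=0$ for all $X\in\ker(F-\mathrm{Id})$, $Y\in\ker(F+\mathrm{Id})$, where $T$ is the torsion tensor of $\nabla$; let $R$ be its curvature tensor. Let $\Delta GL(n,\mathbb R)=\left\{\begin{pmatrix}A&0\\0&A\end{pmatrix}: A\in GL(n,\mathbb R)\right\}$. The $\Delta GL(n,\mathbb R)$-structure defined by $(F,P)$ is the reduction of the bundle of linear frames of $M$ consisting of the frames $(X_1,\dots,X_n,PX_1,\dots,PX_n)$ where $(X_1,\dots,X_n)$ is a basis of $\ker(F-\mathrm{Id})$ at a point; a $G$-structure is called integrable if around every point there are local coordinates whose coordinate frame is, at every point of their domain, a frame of the $G$-structure. Then the following three conditions are equivalent: (i) $T=0$ and $R=0$, i.e. $\nabla$ is locally flat. (ii) For every point $x\in M$ there exist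 an open neighbourhood $U$ of $x$ and local coordinates $(x_1,\dots,x_n,y_1,\dots,y_n)$ on $U$ such that, for all $i=1,\dots,n$, $$F\left(\frac{\partial}{\partial x_i}\right)=\frac{\partial}{\partial y_i},\quad F\left(\frac{\partial}{\partial y_i}\right)=\frac{\partial}{\partial x_i},\quad P\left(\frac{\partial}{\partial x_i}\right)=\frac{\partial}{\partial x_i},\quad P\left(\frac{\partial}{\partial y_i}\right)=-\frac{\partial}{\partial y_i}.$$ (iii) The $\Delta GL(n,\mathbb R)$-structure on $M$ defined by $(F,P)$ is integrable. -/

import Mathlib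

open scoped Manifold ContDiff Topology
open Bundle VectorField FiberBundle

set_option linter.unusedSectionVars false

noncomputable section

/-- The Lie group `ΔGL(n, ℝ)` of the block matrices `diag(A, A)` with `A ∈ GL(n, ℝ)`. -/
def DeltaGL (n : ℕ) : Subgroup (GL (Fin n ⊕ Fin n) ℝ) where
  carrier := {g | ∃ A : GL (Fin n) ℝ,
    (g : Matrix (Fin n ⊕ Fin n) (Fin n ⊕ Fin n) ℝ) =
      Matrix.fromBlocks (A : Matrix (Fin n) (Fin n) ℝ) 0 0 (A : Matrix (Fin n) (Fin n) ℝ)}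
  mul_mem' := by
    rintro a b ⟨A, hA⟩ ⟨B, hB⟩
    exact ⟨A * B, by simp [hA, hB, Matrix.fromBlocks_multiply]⟩
  one_mem' := ⟨1, by simp [Matrix.fromBlocks_one]⟩
  inv_mem' := by
    rintro a ⟨A, hA⟩
    refine ⟨A⁻¹, ?_⟩
    have h : (a : Matrix (Fin n ⊕ Fin n) (Fin n ⊕ Fin n) ℝ) *
        Matrix.fromBlocks ((A⁻¹ : GL (Fin n) ℝ) : Matrix (Fin n) (Fin n) ℝ) 0 0
          ((A⁻¹ : GL (Fin n) ℝ) : Matrix (Fin n) (Fin n) ℝ) = 1 := by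
      rw [hA, Matrix.fromBlocks_multiply]
      simp only [← Units.val_mul, mul_inv_cancel]
      simp [Matrix.fromBlocks_one]
    rw [Matrix.coe_units_inv]
    exact Matrix.inv_eq_right_inv h

section Manifold

variable {E : Type*} [NormedAddCommGroup E] [NormedSpace ℝ E]
  {M : Type*} [TopologicalSpace M] [ChartedSpace E M]

variable (E M) in
/-- An almost biparacomplex structure on `M`: two smooth tensor fields `F`, `P` of type `(1,1)` with
`F² = P² = Id` and `F ∘ P + P ∘ F = 0`. -/
structure AlmostBiparacomplex [IsManifold 𝓘(ℝ, E) ∞ M] where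
  F : Π x : M, TangentSpace 𝓘(ℝ, E) x →L[ℝ] TangentSpace 𝓘(ℝ, E) x
  P : Π x : M, TangentSpace 𝓘(ℝ, E) x →L[ℝ] TangentSpace 𝓘(ℝ, E) x
  contMDiff_F : ContMDiff 𝓘(ℝ, E) (𝓘(ℝ, E).prod 𝓘(ℝ, E →L[ℝ] E)) ∞ (fun x ↦
    (⟨x, F x⟩ : TotalSpace (E →L[ℝ] E)
      fun x : M ↦ TangentSpace 𝓘(ℝ, E) x →L[ℝ] TangentSpace 𝓘(ℝ, E) x))
  contMDiff_P : ContMDiff 𝓘(ℝ, E) (𝓘(ℝ, E).prod 𝓘(ℝ, E →L[ℝ] E)) ∞ (fun x ↦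
    (⟨x, P x⟩ : TotalSpace (E →L[ℝ] E)
      fun x : M ↦ TangentSpace 𝓘(ℝ, E) x →L[ℝ] TangentSpace 𝓘(ℝ, E) x))
  F_F : ∀ x v, F x (F x v) = v
  P_P : ∀ x v, P x (P x v) = v
  F_P_add_P_F : ∀ x v, F x (P x v) + P x (F x v) = 0

variable [FiniteDimensional ℝ E] [IsManifold 𝓘(ℝ, E) ∞ M]

/-- The parallelism condition `∇A = 0` for a tensor field `A` of type `(1,1)`:
`∇_v (A Y) = A (∇_v Y)` for all vector fields `Y` and tangent vectors `v`. -/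
def IsParallel (cov : CovariantDerivative 𝓘(ℝ, E) E (TangentSpace 𝓘(ℝ, E) : M → Type _))
    (A : Π x : M, TangentSpace 𝓘(ℝ, E) x →L[ℝ] TangentSpace 𝓘(ℝ, E) x) : Prop :=
  ∀ (Y : Π x : M, TangentSpace 𝓘(ℝ, E) x) (x : M), MDiffAt (T% Y) x →
    ∀ v : TangentSpace 𝓘(ℝ, E) x, cov (fun y ↦ A y (Y y)) x v = A x (cov Y x v)

/-- `R(X, Y) Z = ∇_X ∇_Y Z - ∇_Y ∇_X Z - ∇_[X,Y] Z`. -/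
def curvatureField (cov : CovariantDerivative 𝓘(ℝ, E) E (TangentSpace 𝓘(ℝ, E) : M → Type _))
    (X Y Z : Π x : M, TangentSpace 𝓘(ℝ, E) x) (x : M) : TangentSpace 𝓘(ℝ, E) x :=
  cov (fun y ↦ cov Z y (Y y)) x (X x) - cov (fun y ↦ cov Z y (X y)) x (Y x)
    - cov Z x (mlieBracket 𝓘(ℝ, E) X Y x)

/-- Vanishing of the curvature tensor: `R(X, Y) Z = 0` for all smooth vector fields. -/
def IsCurvatureFree
    (cov : CovariantDerivative 𝓘(ℝ, E) E (TangentSpace 𝓘(ℝ, E) : M → Type _)) : Prop :=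
  ∀ X Y Z : Π x : M, TangentSpace 𝓘(ℝ, E) x, CMDiff ∞ (T% X) → CMDiff ∞ (T% Y) → CMDiff ∞ (T% Z) →
    ∀ x, curvatureField cov X Y Z x = 0

namespace AlmostBiparacomplex

variable (S : AlmostBiparacomplex E M)

/-- The conditions that characterize the canonical connection among smooth linear connections:
`∇F = 0 = ∇P`, and `T(X, Y) = 0` for `X ∈ ker (F - Id)`, `Y ∈ ker (F + Id)`. -/
structure IsCanonicalConnection
    (cov : CovariantDerivative 𝓘(ℝ, E) E (TangentSpace 𝓘(ℝ, E) : M → Type _)) : Prop where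
  smooth : CovariantDerivative.ContMDiffCovariantDerivative cov ∞
  parallel_F : IsParallel cov S.F
  parallel_P : IsParallel cov S.P
  torsion : ∀ (x : M) (u v : TangentSpace 𝓘(ℝ, E) x), S.F x u = u → S.F x v = -v →
    cov.torsion x u v = 0

/-- The projections onto the eigendistributions of `F`, acting on vector fields. -/
def projPos (X : Π x : M, TangentSpace 𝓘(ℝ, E) x) : Π x : M, TangentSpace 𝓘(ℝ, E) x :=
  (2⁻¹ : ℝ) • (X + fun x ↦ S.F x (X x))

def projNeg (X : Π x : M, TangentSpace 𝓘(ℝ, E) x) : Π x : M, TangentSpace 𝓘(ℝ, E) x :=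
  (2⁻¹ : ℝ) • (X - fun x ↦ S.F x (X x))

def applyP (X : Π x : M, TangentSpace 𝓘(ℝ, E) x) : Π x : M, TangentSpace 𝓘(ℝ, E) x :=
  fun x ↦ S.P x (X x)

section algebra
variable {S}
variable (X Y : Π x : M, TangentSpace 𝓘(ℝ, E) x) (g : M → ℝ)

lemma F_P_eq (x : M) (v : TangentSpace 𝓘(ℝ, E) x) : S.F x (S.P x v) = - S.P x (S.F x v) :=
  eq_neg_of_add_eq_zero_left (S.F_P_add_P_F x v)

lemma projPos_add : S.projPos (X + Y) = S.projPos X + S.projPos Y := by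
  ext x; simp [projPos]; module
lemma projNeg_add : S.projNeg (X + Y) = S.projNeg X + S.projNeg Y := by
  ext x; simp [projNeg]; module
lemma applyP_add : S.applyP (X + Y) = S.applyP X + S.applyP Y := by
  ext x; simp [applyP]
lemma projPos_smul : S.projPos (g • X) = g • S.projPos X := by
  ext x; simp [projPos]; module
lemma projNeg_smul : S.projNeg (g • X) = g • S.projNeg X := by
  ext x; simp [projNeg]; module
lemma applyP_smul : S.applyP (g • X) = g • S.applyP X := by
  ext x; simp [applyP]
lemma projPos_neg : S.projPos (-X) = - S.projPos X := by
  ext x; simp [projPos]; module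
lemma projNeg_neg : S.projNeg (-X) = - S.projNeg X := by
  ext x; simp [projNeg]; module
lemma projPos_projPos : S.projPos (S.projPos X) = S.projPos X := by
  ext x; simp [projPos, S.F_F]; module
lemma projNeg_projNeg : S.projNeg (S.projNeg X) = S.projNeg X := by
  ext x; simp [projNeg, S.F_F]; module
lemma projPos_projNeg : S.projPos (S.projNeg X) = 0 := by
  ext x; simp [projPos, projNeg, S.F_F]; module
lemma projNeg_projPos : S.projNeg (S.projPos X) = 0 := by
  ext x; simp [projPos, projNeg, S.F_F]; module
lemma applyP_applyP : S.applyP (S.applyP X) = X := by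
  ext x; simp [applyP, S.P_P]
lemma applyP_projPos : S.applyP (S.projPos X) = S.projNeg (S.applyP X) := by
  ext x; simp [projPos, projNeg, applyP, F_P_eq]
lemma applyP_projNeg : S.applyP (S.projNeg X) = S.projPos (S.applyP X) := by
  ext x; simp [projPos, projNeg, applyP, F_P_eq]; module
lemma projPos_F : S.projPos (fun x ↦ S.F x (X x)) = S.projPos X := by
  ext x; simp [projPos, S.F_F]; module
lemma projNeg_F : S.projNeg (fun x ↦ S.F x (X x)) = - S.projNeg X := by
  ext x; simp [projNeg, S.F_F]; module
lemma projPos_add_projNeg : S.projPos X + S.projNeg X = X := by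
  ext x; simp [projPos, projNeg]; module
lemma F_projPos (x) : S.F x (S.projPos X x) = S.projPos X x := by
  simp [projPos, S.F_F]; module
lemma F_projNeg (x) : S.F x (S.projNeg X x) = - S.projNeg X x := by
  simp [projNeg, S.F_F]; module
end algebra

section smoothness
variable {S} {X : Π x : M, TangentSpace 𝓘(ℝ, E) x} {x : M} 

lemma contMDiffAt_applyP (h : CMDiffAt ∞ (T% X) x) : CMDiffAt ∞ (T% (S.applyP X)) x :=
  (S.contMDiff_P x).clm_bundle_apply h
lemma contMDiffAt_projPos (h : CMDiffAt ∞ (T% X) x) : CMDiffAt ∞ (T% (S.projPos X)) x :=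
  (h.add_section ((S.contMDiff_F x).clm_bundle_apply h)).const_smul_section
lemma contMDiffAt_projNeg (h : CMDiffAt ∞ (T% X) x) : CMDiffAt ∞ (T% (S.projNeg X)) x :=
  (h.sub_section ((S.contMDiff_F x).clm_bundle_apply h)).const_smul_section
lemma mdiffAt_applyF (h : MDiffAt (T% X) x) : MDiffAt (T% (fun y ↦ S.F y (X y))) x :=
  ((S.contMDiff_F x).mdifferentiableAt (by simp)).clm_bundle_apply h
lemma mdiffAt_applyP (h : MDiffAt (T% X) x) : MDiffAt (T% (S.applyP X)) x :=
  ((S.contMDiff_P x).mdifferentiableAt (by simp)).clm_bundle_apply h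
lemma mdiffAt_projPos (h : MDiffAt (T% X) x) : MDiffAt (T% (S.projPos X)) x :=
  MDifferentiableAt.smul_section (f := fun _ : M ↦ (2⁻¹ : ℝ)) mdifferentiableAt_const
    (mdifferentiableAt_add_section h (mdiffAt_applyF h))
lemma mdiffAt_projNeg (h : MDiffAt (T% X) x) : MDiffAt (T% (S.projNeg X)) x :=
  MDifferentiableAt.smul_section (f := fun _ : M ↦ (2⁻¹ : ℝ)) mdifferentiableAt_const
    (mdifferentiableAt_sub_section h (mdiffAt_applyF h))

end smoothness


/-- The expression `F⁺([F⁻X, F⁺Y] + P[F⁺X, P F⁺Y]) + F⁻([F⁺X, F⁻Y] + P[F⁻X, P F⁻Y])`. -/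
def canonicalDeriv (Y X : Π x : M, TangentSpace 𝓘(ℝ, E) x) : Π x : M, TangentSpace 𝓘(ℝ, E) x :=
  S.projPos (mlieBracket 𝓘(ℝ, E) (S.projNeg X) (S.projPos Y)
      + S.applyP (mlieBracket 𝓘(ℝ, E) (S.projPos X) (S.applyP (S.projPos Y))))
    + S.projNeg (mlieBracket 𝓘(ℝ, E) (S.projPos X) (S.projNeg Y)
      + S.applyP (mlieBracket 𝓘(ℝ, E) (S.projNeg X) (S.applyP (S.projNeg Y))))

lemma canonicalDeriv_apply (Y X : Π x : M, TangentSpace 𝓘(ℝ, E) x) (x : M) :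
    S.canonicalDeriv Y X x =
      (2⁻¹ : ℝ) • (((mlieBracket 𝓘(ℝ, E) (S.projNeg X) (S.projPos Y) x
        + S.P x (mlieBracket 𝓘(ℝ, E) (S.projPos X) (S.applyP (S.projPos Y)) x))
      + S.F x (mlieBracket 𝓘(ℝ, E) (S.projNeg X) (S.projPos Y) x
        + S.P x (mlieBracket 𝓘(ℝ, E) (S.projPos X) (S.applyP (S.projPos Y)) x)))
      + ((mlieBracket 𝓘(ℝ, E) (S.projPos X) (S.projNeg Y) x
        + S.P x (mlieBracket 𝓘(ℝ, E) (S.projNeg X) (S.applyP (S.projNeg Y)) x))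
      - S.F x (mlieBracket 𝓘(ℝ, E) (S.projPos X) (S.projNeg Y) x
        + S.P x (mlieBracket 𝓘(ℝ, E) (S.projNeg X) (S.applyP (S.projNeg Y)) x)))) := by
  simp [canonicalDeriv, projPos, projNeg, applyP]

section deriv
variable {S} {X X' Y Y' : Π x : M, TangentSpace 𝓘(ℝ, E) x} {x : M} {f : M → ℝ}

lemma canonicalDeriv_add_left (hY : MDiffAt (T% Y) x) (hY' : MDiffAt (T% Y') x) :
    S.canonicalDeriv (Y + Y') X x = S.canonicalDeriv Y X x + S.canonicalDeriv Y' X x := by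
  simp only [canonicalDeriv_apply, projPos_add, projNeg_add, applyP_add]
  rw [mlieBracket_add_right (mdiffAt_projPos hY) (mdiffAt_projPos hY'),
    mlieBracket_add_right (mdiffAt_projNeg hY) (mdiffAt_projNeg hY'),
    mlieBracket_add_right (mdiffAt_applyP (mdiffAt_projPos hY))
      (mdiffAt_applyP (mdiffAt_projPos hY')),
    mlieBracket_add_right (mdiffAt_applyP (mdiffAt_projNeg hY))
      (mdiffAt_applyP (mdiffAt_projNeg hY'))]
  simp only [map_add]
  module

lemma canonicalDeriv_add_right (hX : MDiffAt (T% X) x) (hX' : MDiffAt (T% X') x) :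
    S.canonicalDeriv Y (X + X') x = S.canonicalDeriv Y X x + S.canonicalDeriv Y X' x := by
  simp only [canonicalDeriv_apply, projPos_add, projNeg_add]
  simp only [mlieBracket_add_left (mdiffAt_projPos (S := S) hX) (mdiffAt_projPos hX'),
    mlieBracket_add_left (mdiffAt_projNeg (S := S) hX) (mdiffAt_projNeg hX'), map_add]
  module

lemma canonicalDeriv_smul_right (hf : MDiffAt f x) (hX : MDiffAt (T% X) x) :
    S.canonicalDeriv Y (f • X) x = f x • S.canonicalDeriv Y X x := by
  have h1 := F_projPos (S := S) X x
  have h2 := F_projNeg (S := S) X x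
  simp only [canonicalDeriv_apply, projPos_smul, projNeg_smul]
  simp only [mlieBracket_smul_left hf (mdiffAt_projPos (S := S) hX),
    mlieBracket_smul_left hf (mdiffAt_projNeg (S := S) hX), map_add, map_smul, map_neg, neg_smul,
    F_P_eq, h1, h2]
  module

lemma canonicalDeriv_smul_left (hf : MDiffAt f x) (hY : MDiffAt (T% Y) x) :
    S.canonicalDeriv (f • Y) X x = f x • S.canonicalDeriv Y X x + d% f x (X x) • Y x := by
  have h1 := F_projPos (S := S) Y x
  have h2 := F_projNeg (S := S) Y x
  have h3 : S.P x (S.applyP (S.projPos Y) x) = S.projPos Y x := S.P_P _ _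
  have h4 : S.P x (S.applyP (S.projNeg Y) x) = S.projNeg Y x := S.P_P _ _
  have hX' : X x = S.projPos X x + S.projNeg X x :=
    congrFun (projPos_add_projNeg (S := S) X).symm x
  have hY' : Y x = S.projPos Y x + S.projNeg Y x :=
    congrFun (projPos_add_projNeg (S := S) Y).symm x
  simp only [canonicalDeriv_apply, projPos_smul, projNeg_smul, applyP_smul]
  rw [mlieBracket_smul_right hf (mdiffAt_projPos (S := S) hY),
    mlieBracket_smul_right hf (mdiffAt_projNeg (S := S) hY),
    mlieBracket_smul_right hf (mdiffAt_applyP (mdiffAt_projPos (S := S) hY)),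
    mlieBracket_smul_right hf (mdiffAt_applyP (mdiffAt_projNeg (S := S) hY)), hX', hY']
  simp only [map_add, map_smul, h1, h2, h3, h4]
  module

lemma tensorialAt_canonicalDeriv (Y : Π x : M, TangentSpace 𝓘(ℝ, E) x) (x : M) :
    TensorialAt 𝓘(ℝ, E) E (fun X ↦ S.canonicalDeriv Y X x) x where
  smul hf hX := canonicalDeriv_smul_right hf hX
  add hX hX' := canonicalDeriv_add_right hX hX'

end deriv

/-- The connection given by the explicit formula, used to prove existence. -/
def explicitConnection :
    CovariantDerivative 𝓘(ℝ, E) E (TangentSpace 𝓘(ℝ, E) : M → Type _) where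
  toFun Y x := TensorialAt.mkHom (F := E) (fun X ↦ S.canonicalDeriv Y X x) x
    (tensorialAt_canonicalDeriv Y x)
  isCovariantDerivativeOnUniv :=
    { add := fun {Y Y' x} hY hY' _ ↦ by
        ext v
        simp [TensorialAt.mkHom_apply_eq_extend, canonicalDeriv_add_left hY hY']
      leibniz := fun {Y f x} hY hf _ ↦ by
        ext v
        simp [TensorialAt.mkHom_apply_eq_extend,
          canonicalDeriv_smul_left hf hY] }

variable {S} in
lemma explicitConnection_apply {X Y : Π x : M, TangentSpace 𝓘(ℝ, E) x} {x : M}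
    (hX : MDiffAt (T% X) x) : S.explicitConnection Y x (X x) = S.canonicalDeriv Y X x :=
  TensorialAt.mkHom_apply (tensorialAt_canonicalDeriv Y x) hX

section properties
variable {S} {X Y : Π x : M, TangentSpace 𝓘(ℝ, E) x} {x : M}

lemma mlieBracket_neg (hY : MDiffAt (T% Y) x) :
    mlieBracket 𝓘(ℝ, E) X (-Y) x = - mlieBracket 𝓘(ℝ, E) X Y x := by
  simpa using mlieBracket_const_smul_right (I := 𝓘(ℝ, E)) (c := (-1 : ℝ)) (V := X) hY

lemma canonicalDeriv_applyF (hY : MDiffAt (T% Y) x) :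
    S.canonicalDeriv (fun y ↦ S.F y (Y y)) X x = S.F x (S.canonicalDeriv Y X x) := by
  have e : S.applyP (-S.projNeg Y) = - S.applyP (S.projNeg Y) := by
    ext x; simp [applyP]
  simp only [canonicalDeriv_apply, projPos_F, projNeg_F, e]
  rw [mlieBracket_neg (mdiffAt_projNeg hY), mlieBracket_neg (mdiffAt_applyP (mdiffAt_projNeg hY))]
  simp only [map_add, map_smul, map_sub, map_neg, S.F_F]
  module

lemma canonicalDeriv_applyP :
    S.canonicalDeriv (S.applyP Y) X x = S.P x (S.canonicalDeriv Y X x) := by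
  have e1 : S.projPos (S.applyP Y) = S.applyP (S.projNeg Y) := (applyP_projNeg Y).symm
  have e2 : S.projNeg (S.applyP Y) = S.applyP (S.projPos Y) := (applyP_projPos Y).symm
  simp only [canonicalDeriv_apply, e1, e2, applyP_applyP]
  simp only [map_add, map_smul, map_sub, map_neg, F_P_eq, S.P_P]
  module

lemma canonicalDeriv_pos_neg (x : M) :
    S.canonicalDeriv (S.projNeg Y) (S.projPos X) x
      - S.canonicalDeriv (S.projPos X) (S.projNeg Y) x
      = mlieBracket 𝓘(ℝ, E) (S.projPos X) (S.projNeg Y) x := by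
  have e : S.applyP 0 = 0 := by ext x; simp [applyP]
  simp only [canonicalDeriv_apply, projPos_projPos, projNeg_projNeg, projNeg_projPos,
    projPos_projNeg, e, mlieBracket_zero_left, mlieBracket_zero_right, Pi.zero_apply, map_zero]
  rw [mlieBracket_swap_apply (V := S.projNeg Y)]
  simp only [map_neg, add_zero, zero_add, map_zero, sub_zero]
  module

lemma contMDiffAt_canonicalDeriv (hX : CMDiffAt ∞ (T% X) x) (hY : CMDiffAt ∞ (T% Y) x) :
    CMDiffAt ∞ (T% (S.canonicalDeriv Y X)) x := by
  have hb : ∀ {U V : Π x : M, TangentSpace 𝓘(ℝ, E) x}, CMDiffAt ∞ (T% U) x →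
      CMDiffAt ∞ (T% V) x → CMDiffAt ∞ (T% (mlieBracket 𝓘(ℝ, E) U V)) x := by
    intro U V hU hV
    have : IsManifold 𝓘(ℝ, E) (((⊤ : ℕ∞) : ℕ∞ω) + 1) M := ‹IsManifold 𝓘(ℝ, E) ∞ M›
    have : IsManifold 𝓘(ℝ, E) (minSmoothness ℝ 2) M := by
      rw [minSmoothness_of_isRCLikeNormedField]; infer_instance
    exact ContMDiffAt.mlieBracket_vectorField (m := ⊤) (n := ⊤) hU hV (by simp)
  exact (contMDiffAt_projPos ((hb (contMDiffAt_projNeg hX) (contMDiffAt_projPos hY)).add_section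
    (contMDiffAt_applyP (hb (contMDiffAt_projPos hX)
      (contMDiffAt_applyP (contMDiffAt_projPos hY)))))).add_section
    (contMDiffAt_projNeg ((hb (contMDiffAt_projPos hX) (contMDiffAt_projNeg hY)).add_section
    (contMDiffAt_applyP (hb (contMDiffAt_projNeg hX)
      (contMDiffAt_applyP (contMDiffAt_projNeg hY))))))

end properties

lemma contMDiff_explicitConnection :
    CovariantDerivative.ContMDiffCovariantDerivative S.explicitConnection ∞ where
  contMDiff :=
    { contMDiff := by
        intro Y hY x₀ _
        rw [contMDiffWithinAt_univ, contMDiffAt_hom_bundle]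
        refine ⟨contMDiffAt_id, ?_⟩
        have hY' : CMDiff ∞ (T% Y) := contMDiffOn_univ.1 hY
        let t := trivializationAt E (TangentSpace 𝓘(ℝ, E) : M → Type _) x₀
        let b := Module.finBasis ℝ E
        have hx₀ : t.baseSet ∈ 𝓝 x₀ :=
          t.open_baseSet.mem_nhds (FiberBundle.mem_baseSet_trivializationAt' x₀)
        have key : ∀ A : E →L[ℝ] E, A = ∑ i, ContinuousLinearMap.smulRightL ℝ E E
            (LinearMap.toContinuousLinearMap (b.coord i)) (A (b i)) := by
          intro A
          ext v
          conv_lhs => rw [← b.sum_repr v, map_sum]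
          simp
        have hsum := fun x : M ↦ key (ContinuousLinearMap.inCoordinates E
          (TangentSpace 𝓘(ℝ, E) : M → Type _) E (TangentSpace 𝓘(ℝ, E) : M → Type _) x₀ x x₀ x
          (S.explicitConnection Y x))
        refine ContMDiffAt.congr_of_eventuallyEq ?_ (Filter.Eventually.of_forall hsum)
        refine ContMDiffAt.sum fun i _ ↦ ?_
        refine (ContinuousLinearMap.contMDiff _).contMDiffAt.comp x₀ ?_
        have hZ : ∀ x ∈ t.baseSet, CMDiffAt ∞ (T% (t.localFrame b i)) x :=
          fun x hx ↦ contMDiffAt_localFrame_of_mem ∞ t b i hx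
        have h := (contMDiffAt_section _).1 (contMDiffAt_canonicalDeriv (S := S)
          (hZ x₀ (FiberBundle.mem_baseSet_trivializationAt' x₀)) (hY' x₀))
        refine h.congr_of_eventuallyEq ?_
        filter_upwards [hx₀] with x hx
        have hd : MDiffAt (T% (t.localFrame b i)) x := (hZ x hx).mdifferentiableAt (by simp)
        rw [← explicitConnection_apply hd]
        rw [ContinuousLinearMap.inCoordinates_eq hx hx]
        have e1 : t.localFrame b i x = t.symmL ℝ x (b i) := by
          rw [t.localFrame_apply_of_mem_baseSet b hx]
          simp [Trivialization.basisAt, t.symmL_apply hx]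
        rw [e1, t.symmL_apply hx]
        rfl }

theorem isCanonicalConnection_explicitConnection :
    S.IsCanonicalConnection S.explicitConnection where
  smooth := S.contMDiff_explicitConnection
  parallel_F Y x hY v := by
    have h := mdifferentiableAt_extend 𝓘(ℝ, E) E v
    have hv : extend E v x = v := by simp
    rw [← hv, explicitConnection_apply h, explicitConnection_apply h, canonicalDeriv_applyF hY]
  parallel_P Y x hY v := by
    have h := mdifferentiableAt_extend 𝓘(ℝ, E) E v
    have hv : extend E v x = v := by simp
    rw [← hv, explicitConnection_apply h, explicitConnection_apply h]
    exact canonicalDeriv_applyP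
  torsion x u v hu hv := by
    have h1 := mdiffAt_projPos (S := S) (mdifferentiableAt_extend 𝓘(ℝ, E) E u)
    have h2 := mdiffAt_projNeg (S := S) (mdifferentiableAt_extend 𝓘(ℝ, E) E v)
    have e1 : S.projPos (extend E u) x = u := by simp [projPos, hu]; module
    have e2 : S.projNeg (extend E v) x = v := by simp [projNeg, hv]; module
    have := CovariantDerivative.torsion_apply S.explicitConnection h1 h2
    rw [explicitConnection_apply h1, explicitConnection_apply h2, canonicalDeriv_pos_neg, e1, e2]
      at this
    rw [this, sub_self]

/-- Existence of the canonical connection. -/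
theorem exists_isCanonicalConnection :
    ∃ cov : CovariantDerivative 𝓘(ℝ, E) E (TangentSpace 𝓘(ℝ, E) : M → Type _),
      S.IsCanonicalConnection cov :=
  ⟨_, S.isCanonicalConnection_explicitConnection⟩

/-- The canonical connection of `(F, P)`: the connection with the characterizing properties of
`IsCanonicalConnection` (it exists, and it is unique on differentiable vector fields). -/
def canonicalConnection :
    CovariantDerivative 𝓘(ℝ, E) E (TangentSpace 𝓘(ℝ, E) : M → Type _) :=
  S.exists_isCanonicalConnection.choose

theorem isCanonicalConnection_canonicalConnection :
    S.IsCanonicalConnection S.canonicalConnection :=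
  S.exists_isCanonicalConnection.choose_spec

variable {S} in
/-- Uniqueness of the canonical connection (covariant derivatives in Mathlib take junk values on
non-differentiable fields). -/
theorem IsCanonicalConnection.eq {cov cov' : CovariantDerivative 𝓘(ℝ, E) E
    (TangentSpace 𝓘(ℝ, E) : M → Type _)} (h : S.IsCanonicalConnection cov)
    (h' : S.IsCanonicalConnection cov') {Y : Π x : M, TangentSpace 𝓘(ℝ, E) x} {x : M}
    (hY : MDiffAt (T% Y) x) : cov Y x = cov' Y x := by
  suffices H : ∀ {c : CovariantDerivative 𝓘(ℝ, E) E (TangentSpace 𝓘(ℝ, E) : M → Type _)},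
      S.IsCanonicalConnection c → ∀ {X : Π x : M, TangentSpace 𝓘(ℝ, E) x}, MDiffAt (T% X) x →
        c Y x (X x) = S.canonicalDeriv Y X x by
    ext v
    have hv : extend E v x = v := by simp
    rw [← hv, H h (mdifferentiableAt_extend ..), H h' (mdifferentiableAt_extend ..)]
  intro c hc X hX
  have hF : ∀ {Z : Π x : M, TangentSpace 𝓘(ℝ, E) x}, MDiffAt (T% Z) x → ∀ v,
      S.F x (c (S.projPos Z) x v) = c (S.projPos Z) x v ∧
      S.F x (c (S.projNeg Z) x v) = - c (S.projNeg Z) x v := by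
    intro Z hZ v
    have e1 : (fun y ↦ S.F y (S.projPos Z y)) = S.projPos Z := funext fun y ↦ F_projPos Z y
    have e2 : (fun y ↦ S.F y (S.projNeg Z y)) = (-1 : ℝ) • S.projNeg Z :=
      funext fun y ↦ by simp [F_projNeg Z y]
    have a1 := hc.parallel_F _ x (mdiffAt_projPos (S := S) hZ) v
    have a2 := hc.parallel_F _ x (mdiffAt_projNeg (S := S) hZ) v
    rw [e1] at a1
    rw [e2, c.isCovariantDerivativeOnUniv.smul_const _ (mdiffAt_projNeg hZ)] at a2
    exact ⟨a1.symm, by rw [← a2]; simp⟩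
  have hT : ∀ {U V : Π x : M, TangentSpace 𝓘(ℝ, E) x}, MDiffAt (T% U) x → MDiffAt (T% V) x →
      c (S.projNeg V) x (S.projPos U x) - c (S.projPos U) x (S.projNeg V x)
        = mlieBracket 𝓘(ℝ, E) (S.projPos U) (S.projNeg V) x := by
    intro U V hU hV
    have := hc.torsion x _ _ (F_projPos U x) (F_projNeg V x)
    rwa [CovariantDerivative.torsion_apply c (mdiffAt_projPos hU) (mdiffAt_projNeg hV),
      sub_eq_zero] at this
  have hPN : ∀ {U V : Π x : M, TangentSpace 𝓘(ℝ, E) x}, MDiffAt (T% U) x → MDiffAt (T% V) x →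
      c (S.projNeg V) x (S.projPos U x)
        = S.projNeg (mlieBracket 𝓘(ℝ, E) (S.projPos U) (S.projNeg V)) x ∧
      c (S.projPos U) x (S.projNeg V x)
        = S.projPos (mlieBracket 𝓘(ℝ, E) (S.projNeg V) (S.projPos U)) x := by
    intro U V hU hV
    have a := hT hU hV
    have b1 := (hF hU (S.projNeg V x)).1
    have b2 := (hF hV (S.projPos U x)).2
    constructor
    · simp only [projNeg, Pi.smul_apply, Pi.sub_apply] at a b1 b2 ⊢
      rw [← a, map_sub, b1, b2]
      module
    · rw [mlieBracket_swap]
      simp only [projPos, Pi.smul_apply, Pi.add_apply, Pi.neg_apply] at a b1 b2 ⊢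
      rw [← a, map_neg, map_sub, b1, b2]
      module
  have hP : ∀ {Z : Π x : M, TangentSpace 𝓘(ℝ, E) x}, MDiffAt (T% Z) x → ∀ v,
      c Z x v = S.P x (c (S.applyP Z) x v) := by
    intro Z hZ v
    rw [show c (S.applyP Z) x v = S.P x (c Z x v) from hc.parallel_P Z x hZ v, S.P_P]
  have hX' : X x = S.projPos X x + S.projNeg X x :=
    congrFun (projPos_add_projNeg (S := S) X).symm x
  have hY' : c Y x = c (S.projPos Y) x + c (S.projNeg Y) x := by
    rw [← c.isCovariantDerivativeOnUniv.add (mdiffAt_projPos hY) (mdiffAt_projNeg hY),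
      projPos_add_projNeg]
  have k1 : c (S.projPos Y) x (S.projPos X x) =
      S.projPos (S.applyP (mlieBracket 𝓘(ℝ, E) (S.projPos X) (S.applyP (S.projPos Y)))) x := by
    rw [hP (mdiffAt_projPos hY), applyP_projPos, (hPN hX (mdiffAt_applyP hY)).1]
    exact congrFun (applyP_projNeg _) x
  have k2 : c (S.projNeg Y) x (S.projNeg X x) =
      S.projNeg (S.applyP (mlieBracket 𝓘(ℝ, E) (S.projNeg X) (S.applyP (S.projNeg Y)))) x := by
    rw [hP (mdiffAt_projNeg hY), applyP_projNeg, (hPN (mdiffAt_applyP hY) hX).2]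
    exact congrFun (applyP_projPos _) x
  rw [hX', hY', canonicalDeriv, projPos_add, projNeg_add]
  simp only [add_apply, map_add, k1, k2, (hPN hX hY).1, (hPN hY hX).2,
    Pi.add_apply]
  abel

end AlmostBiparacomplex

variable (E M) in
/-- A `G`-structure on `M`, where `G` is a subgroup of `GL(ι, ℝ)`: a smooth reduction to `G` of the
bundle of linear frames. Its fibres are sets of frames `u : Basis ι ℝ (T_x M)` which are orbits of
the right action `(u · g)_j = ∑ i, g i j • u_i`, and near each point it has a smooth local
section. -/
structure GStructure {ι : Type*} [Fintype ι] [DecidableEq ι] (G : Subgroup (GL ι ℝ)) where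
  frames : Π x : M, Set (Module.Basis ι ℝ (TangentSpace 𝓘(ℝ, E) x))
  mem_iff : ∀ (x : M), ∀ u ∈ frames x, ∀ v : Module.Basis ι ℝ (TangentSpace 𝓘(ℝ, E) x),
    v ∈ frames x ↔ ∃ g ∈ G, ∀ j, v j = ∑ i, (g : Matrix ι ι ℝ) i j • u i
  exists_section : ∀ x : M, ∃ (U : Set M) (s : ι → Π y : M, TangentSpace 𝓘(ℝ, E) y)
    (hs : IsLocalFrameOn 𝓘(ℝ, E) E ∞ s U), IsOpen U ∧ x ∈ U ∧
      ∀ y (hy : y ∈ U), hs.toBasisAt hy ∈ frames y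

/-- Smooth local coordinates `(x_i)_{i ∈ ι}` on an open subset (`φ.source`) of `M`. -/
structure IsSmoothCoordinates {ι : Type*} [Fintype ι]
    (φ : OpenPartialHomeomorph M (EuclideanSpace ℝ ι)) : Prop where
  contMDiffOn : CMDiff[φ.source] ∞ φ
  contMDiffOn_symm : CMDiff[φ.target] ∞ φ.symm

/-- The coordinate vector field `∂/∂x_i` of the coordinates `φ`: the vector field on `φ.source`
which is `φ`-related to the `i`-th standard constant vector field. -/
def coordField {ι : Type*} [Fintype ι] [DecidableEq ι]
    (φ : OpenPartialHomeomorph M (EuclideanSpace ℝ ι)) (i : ι) :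
    Π y : M, TangentSpace 𝓘(ℝ, E) y :=
  mpullback 𝓘(ℝ, E) 𝓘(ℝ, EuclideanSpace ℝ ι) φ (fun _ ↦ EuclideanSpace.single i (1 : ℝ))

/-- A `G`-structure is integrable if near each point there are coordinates whose coordinate frame
is a section of it. -/
def GStructure.IsIntegrable {ι : Type*} [Fintype ι] [DecidableEq ι] {G : Subgroup (GL ι ℝ)}
    (B : GStructure E M G) : Prop :=
  ∀ x : M, ∃ φ : OpenPartialHomeomorph M (EuclideanSpace ℝ ι),
    x ∈ φ.source ∧ IsSmoothCoordinates (E := E) φ ∧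
      ∀ y ∈ φ.source, ∃ u ∈ B.frames y, ∀ i, u i = coordField φ i y

namespace AlmostBiparacomplex

variable (S : AlmostBiparacomplex E M)

/-- Near each point there are coordinates `(x₁, …, x_n, y₁, …, y_n)` (indexed by `Fin n ⊕ Fin n`)
with `F ∂x_i = ∂y_i`, `F ∂y_i = ∂x_i`, `P ∂x_i = ∂x_i`, `P ∂y_i = -∂y_i`. -/
def HasStandardCoordinates (n : ℕ) : Prop :=
  ∀ x : M, ∃ φ : OpenPartialHomeomorph M (EuclideanSpace ℝ (Fin n ⊕ Fin n)),
    x ∈ φ.source ∧ IsSmoothCoordinates (E := E) φ ∧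
      ∀ y ∈ φ.source, ∀ i : Fin n,
        S.F y (coordField φ (.inl i) y) = coordField φ (.inr i) y ∧
        S.F y (coordField φ (.inr i) y) = coordField φ (.inl i) y ∧
        S.P y (coordField φ (.inl i) y) = coordField φ (.inl i) y ∧
        S.P y (coordField φ (.inr i) y) = - coordField φ (.inr i) y

/-- The frames `(X₁, …, X_n, P X₁, …, P X_n)` with `X₁, …, X_n` in `ker (F - Id)`. -/
def adaptedFrames (n : ℕ) (x : M) :
    Set (Module.Basis (Fin n ⊕ Fin n) ℝ (TangentSpace 𝓘(ℝ, E) x)) :=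
  {u | ∀ i, S.F x (u (.inl i)) = u (.inl i) ∧ u (.inr i) = S.P x (u (.inl i))}

lemma eq_of_add_of_add_neg {V : Type*} [AddCommGroup V] [Module ℝ V] {a b c : V}
    (h1 : a + b = c) (h2 : a + -b = c) : c = a := by
  have h3 : (2 : ℝ) • c = (2 : ℝ) • a := by
    rw [two_smul]
    nth_rewrite 1 [← h1]
    rw [← h2]
    module
  exact smul_right_injective _ (two_ne_zero' ℝ) h3

variable {S} in
lemma adaptedFrames_mem_iff {n : ℕ} {x : M} {u : Module.Basis (Fin n ⊕ Fin n) ℝ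
    (TangentSpace 𝓘(ℝ, E) x)} (hu : u ∈ S.adaptedFrames n x)
    (v : Module.Basis (Fin n ⊕ Fin n) ℝ (TangentSpace 𝓘(ℝ, E) x)) :
    v ∈ S.adaptedFrames n x ↔ ∃ g ∈ DeltaGL n, ∀ j,
      v j = ∑ i, (g : Matrix (Fin n ⊕ Fin n) (Fin n ⊕ Fin n) ℝ) i j • u i := by
  constructor
  · intro hv
    have hFr : ∀ i, S.F x (u (.inr i)) = - u (.inr i) := by
      intro i
      rw [(hu i).2, F_P_eq, (hu i).1]
    have hv1 : ∀ j, v (.inl j) = ∑ i, u.repr (v (.inl j)) (.inl i) • u (.inl i) := by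
      intro j
      have h1 := u.sum_repr (v (.inl j))
      have h2 := congrArg (S.F x) h1
      rw [(hv j).1] at h2
      simp only [Fintype.sum_sum_type, map_add, map_sum, map_smul, hFr, (hu _).1, smul_neg,
        Finset.sum_neg_distrib] at h1 h2
      exact eq_of_add_of_add_neg h1 h2
    have hv2 : ∀ j, v (.inr j) = ∑ i, u.repr (v (.inl j)) (.inl i) • u (.inr i) := by
      intro j
      rw [(hv j).2]
      conv_lhs => rw [hv1 j]
      simp [(hu _).2]
    obtain ⟨A, hA⟩ : ∃ A : Matrix (Fin n) (Fin n) ℝ,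
      ∀ i j, A i j = u.repr (v (.inl j)) (.inl i) := ⟨fun i j ↦ _, fun _ _ ↦ rfl⟩
    let B : Matrix (Fin n ⊕ Fin n) (Fin n ⊕ Fin n) ℝ := Matrix.fromBlocks A 0 0 A
    have hvB : ∀ j, v j = ∑ i, B i j • u i := by
      rintro (j | j)
      · simpa [B, hA] using hv1 j
      · simpa [B, hA] using hv2 j
    have hB : B = u.toMatrix v := by
      ext i j
      rw [Module.Basis.toMatrix_apply, hvB j]
      simp [-Fintype.sum_sum_type, Finsupp.single_apply]
    have hBu : IsUnit B.det := by
      rw [hB]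
      exact (Matrix.isUnit_iff_isUnit_det _).1
        (IsUnit.of_mul_eq_one _ (u.toMatrix_mul_toMatrix_flip v))
    have hAu : IsUnit A.det := by
      rw [Matrix.det_fromBlocks_zero₂₁] at hBu
      exact isUnit_of_mul_isUnit_left hBu
    exact ⟨Matrix.GeneralLinearGroup.mk'' B hBu, ⟨Matrix.GeneralLinearGroup.mk'' A hAu, rfl⟩, hvB⟩
  · rintro ⟨g, ⟨A, hA⟩, hv⟩ i
    simp only [hA] at hv
    simp [hv, (hu _).1, (hu _).2]

lemma exists_adapted_frame {n : ℕ} (hn : Module.finrank ℝ E = 2 * n) (x : M) :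
    (S.adaptedFrames n x).Nonempty := by
  let T := TangentSpace 𝓘(ℝ, E) x
  have : FiniteDimensional ℝ T := inferInstanceAs (FiniteDimensional ℝ E)
  let K : Submodule ℝ T :=
    { carrier := {v | S.F x v = v}
      add_mem' := fun {a b} ha hb ↦ by
        simp only [Set.mem_ofPred_eq] at ha hb ⊢
        rw [map_add, ha, hb]
      zero_mem' := by simp
      smul_mem' := fun c v hv ↦ by
        simp only [Set.mem_ofPred_eq] at hv ⊢
        rw [map_smul, hv] }
  have hK : ∀ v : K, S.F x (v : T) = v := fun v ↦ v.2
  let f : (K × K) →ₗ[ℝ] T := LinearMap.coprod K.subtype ((S.P x : T →ₗ[ℝ] T) ∘ₗ K.subtype)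
  have hf : ∀ p : K × K, f p = (p.1 : T) + S.P x (p.2 : T) := fun p ↦ rfl
  have hfb : Function.Bijective f := by
    constructor
    · rw [← LinearMap.ker_eq_bot, LinearMap.ker_eq_bot']
      rintro ⟨a, b⟩ h
      rw [hf] at h
      have h2 := congrArg (S.F x) h
      simp only [map_add, F_P_eq, hK, map_zero] at h h2
      have ha' : (a : T) = 0 := (eq_of_add_of_add_neg h h2).symm
      rw [ha', zero_add] at h
      have hb' := congrArg (S.P x) h
      rw [S.P_P, map_zero] at hb'
      ext1
      · exact Subtype.ext ha'
      · exact Subtype.ext hb'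
    · intro v
      refine ⟨(⟨(2⁻¹ : ℝ) • (v + S.F x v), ?_⟩, ⟨(2⁻¹ : ℝ) • S.P x (v - S.F x v), ?_⟩), ?_⟩
      · change S.F x _ = _
        rw [map_smul, map_add, S.F_F]
        module
      · change S.F x _ = _
        rw [map_smul, F_P_eq, map_sub, map_sub, map_sub, S.F_F]
        module
      · rw [hf]
        simp only [map_smul, S.P_P]
        module
  let e : (K × K) ≃ₗ[ℝ] T := LinearEquiv.ofBijective f hfb
  have hdim : Module.finrank ℝ K = n := by
    have h1 := e.finrank_eq
    rw [Module.finrank_prod] at h1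
    have h2 : Module.finrank ℝ T = 2 * n := hn
    omega
  let b := Module.finBasisOfFinrankEq ℝ K hdim
  refine ⟨(b.prod b).map e, fun i ↦ ⟨?_, ?_⟩⟩
  · simp [e, hf, hK]
  · simp [e, hf]

lemma exists_adapted_section {n : ℕ} (hn : Module.finrank ℝ E = 2 * n) (x : M) :
    ∃ (U : Set M) (s : Fin n ⊕ Fin n → Π y : M, TangentSpace 𝓘(ℝ, E) y)
      (hs : IsLocalFrameOn 𝓘(ℝ, E) E ∞ s U), IsOpen U ∧ x ∈ U ∧
      ∀ y (hy : y ∈ U), hs.toBasisAt hy ∈ S.adaptedFrames n y := by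
  obtain ⟨u, hu⟩ := S.exists_adapted_frame hn x
  let X : Fin n → Π y : M, TangentSpace 𝓘(ℝ, E) y := fun i ↦ S.projPos (extend E (u (.inl i)))
  let s : Fin n ⊕ Fin n → Π y : M, TangentSpace 𝓘(ℝ, E) y := Sum.elim X fun i ↦ S.applyP (X i)
  have hX : ∀ i, X i x = u (.inl i) := by
    intro i
    simp [X, projPos, (hu i).1]
    module
  have hsx : ∀ j, s j x = u j := by
    rintro (i | i)
    · exact hX i
    · change S.P x (X i x) = _
      rw [hX, (hu i).2]
  have hW : ∀ i : Fin n, ∃ W ∈ 𝓝 x, CMDiff[W] ∞ (T% (extend E (u (.inl i)))) :=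
    fun i ↦ exists_contMDiffOn_extend 𝓘(ℝ, E) E (u (.inl i))
  choose W hWn hWs using hW
  let t := trivializationAt E (TangentSpace 𝓘(ℝ, E) : M → Type _) x
  have hxt : x ∈ t.baseSet := FiberBundle.mem_baseSet_trivializationAt' x
  let U₀ : Set M := interior (⋂ i, W i) ∩ t.baseSet
  have hU₀ : IsOpen U₀ := isOpen_interior.inter t.open_baseSet
  have hxU₀ : x ∈ U₀ := ⟨mem_interior_iff_mem_nhds.2 (Filter.iInter_mem.2 hWn), hxt⟩
  have hXs : ∀ i, ∀ y ∈ U₀, CMDiffAt ∞ (T% (X i)) y := by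
    intro i y hy
    exact contMDiffAt_projPos ((hWs i).contMDiffAt
      (Filter.mem_of_superset (mem_interior_iff_mem_nhds.1 hy.1) (Set.iInter_subset W i)))
  have hss : ∀ j, ∀ y ∈ U₀, CMDiffAt ∞ (T% (s j)) y := by
    rintro (i | i) y hy
    · exact hXs i y hy
    · exact contMDiffAt_applyP (hXs i y hy)
  let c : M → (Fin n ⊕ Fin n → E) := fun y j ↦ (t ⟨y, s j y⟩).2
  have hc : ContinuousOn c U₀ := by
    rw [continuousOn_pi]
    intro j y hy
    exact ((t.contMDiffAt_section_iff hy.2).1 (hss j y hy)).continuousAt.continuousWithinAt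
  have hlin : ∀ y ∈ U₀, (LinearIndependent ℝ (c y) ↔ LinearIndependent ℝ (s · y)) := by
    intro y hy
    have e : c y = (t.linearEquivAt ℝ y hy.2).toLinearMap ∘ (s · y) := by
      funext j
      rw [Function.comp_apply, LinearEquiv.coe_coe, t.linearEquivAt_apply]
    rw [e]
    exact LinearMap.linearIndependent_iff _ (LinearEquiv.ker _)
  let U : Set M := U₀ ∩ c ⁻¹' {f | LinearIndependent ℝ f}
  have hU : IsOpen U := hc.isOpen_inter_preimage hU₀ isOpen_setOfPred_linearIndependent
  have hxU : x ∈ U := by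
    refine ⟨hxU₀, (hlin x hxU₀).2 ?_⟩
    rw [show (s · x) = u from funext hsx]
    exact u.linearIndependent
  have hs : IsLocalFrameOn 𝓘(ℝ, E) E ∞ s U :=
    { linearIndependent := fun hy ↦ (hlin _ hy.1).1 hy.2
      generating := fun {y} hy ↦ by
        have : FiniteDimensional ℝ (TangentSpace 𝓘(ℝ, E) y) :=
          inferInstanceAs (FiniteDimensional ℝ E)
        have h2 : Module.finrank ℝ (TangentSpace 𝓘(ℝ, E) y) = 2 * n := hn
        refine (LinearIndependent.span_eq_top_of_card_eq_finrank' ((hlin _ hy.1).1 hy.2) ?_).ge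
        rw [h2]
        simp [two_mul]
      contMDiffOn := fun j y hy ↦ (hss j y hy.1).contMDiffWithinAt }
  refine ⟨U, s, hs, hU, hxU, fun y hy i ↦ ?_⟩
  rw [hs.toBasisAt_coe, hs.toBasisAt_coe]
  exact ⟨F_projPos _ y, rfl⟩

/-- The `ΔGL(n, ℝ)`-structure defined by `(F, P)`. -/
def gStructure (n : ℕ) (hn : Module.finrank ℝ E = 2 * n) : GStructure E M (DeltaGL n) where
  frames := S.adaptedFrames n
  mem_iff _ _ hu := adaptedFrames_mem_iff hu
  exists_section := S.exists_adapted_section hn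

end AlmostBiparacomplex
end Manifold
end

/-! The conditions are proved in the cycle (i) ⇒ (iii) ⇒ (ii) ⇒ (i).

(i) ⇒ (iii). In a chart, ∇ becomes an endomorphism-valued 1-form Γ
(`IsSmoothChart.exists_christoffel`). Vanishing torsion says that Γ is symmetric; vanishing
curvature is the integrability condition of the linear equation dθ = θΓ. So there is a solution with
θ(z₀) = 1 (`exists_hasFDerivAt_of_flat`). Symmetry of Γ makes θ a closed E-valued 1-form, so θ = df,
and f is a chart near z₀ (`exists_flat_coordinates`). If K is a parallel field of endomorphisms,
then θK - K(z₀)θ solves the same linear equation and vanishes at z₀, hence near z₀: in the chart f,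
K is constant. This applies to F and P simultaneously (`exists_chart_forall_isParallel`). A linear
change of coordinates carries an adapted frame at one point to the standard basis, and constancy of
F and P makes the coordinate frame adapted everywhere.

The Frobenius step integrates the equation along rays from z₀. Flatness shows that the first order
variation of a radial solution satisfies the equation of the neighbouring ray up to O(‖h‖²), and
Grönwall's inequality turns this into differentiability.

(iii) ⇒ (ii). If (Xᵢ, PXᵢ) is a coordinate frame, then ½(Xᵢ ± PXᵢ) are eigenvectors of P for ±1,
exchanged by F, and form the coordinate frame of (u + v, u - v).

(ii) ⇒ (i). The formula `canonicalDeriv` combines Lie brackets of fields obtained from its arguments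
by F and P. Where F and P are constant, constant arguments give brackets of constant fields, which
vanish. So the Christoffel symbols are zero, and with them T and R
(`flat_of_hasStandardCoordinates`). -/

noncomputable section

/-! ### Linear total differential equations dw = w A in a normed algebra. -/

section TotalDifferentialEquation

variable {E R : Type*} [NormedAddCommGroup E] [NormedSpace ℝ E] [NormedRing R] [NormedAlgebra ℝ R]

/-- The equation `g' = g * A(z₀ + t y)(y)` along a short ray has a solution on `[0, 1]`. -/
lemma exists_radial_solution [CompleteSpace R] {A : E → E →L[ℝ] R} {z₀ : E} {r C : ℝ}
    (hA : ContinuousOn A (Metric.ball z₀ r)) (hC : ∀ z ∈ Metric.ball z₀ r, ‖A z‖ ≤ C)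
    (hr : C * r ≤ 1 / 2) (w₀ : R) {y : E} (hy : ‖y‖ < r) :
    ∃ g : ℝ → R, g 0 = w₀ ∧ ∀ t ∈ Set.Icc (0 : ℝ) 1,
      HasDerivWithinAt g (g t * A (z₀ + t • y) y) (Set.Icc 0 1) t := by
  have hmem : ∀ t ∈ Set.Icc (0 : ℝ) 1, z₀ + t • y ∈ Metric.ball z₀ r := by
    intro t ht
    rw [mem_ball_iff_norm, add_sub_cancel_left, norm_smul, Real.norm_of_nonneg ht.1]
    nlinarith [norm_nonneg y, ht.2]
  have hr0 : 0 < r := (norm_nonneg y).trans_lt hy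
  have hC0 : 0 ≤ C := (norm_nonneg _).trans (hC z₀ (Metric.mem_ball_self hr0))
  have hAy : ∀ t ∈ Set.Icc (0 : ℝ) 1, ‖A (z₀ + t • y) y‖ ≤ 1 / 2 := by
    intro t ht
    calc ‖A (z₀ + t • y) y‖ ≤ ‖A (z₀ + t • y)‖ * ‖y‖ := ContinuousLinearMap.le_opNorm _ _
      _ ≤ C * r := mul_le_mul (hC _ (hmem t ht)) hy.le (norm_nonneg _) hC0
      _ ≤ 1 / 2 := hr
  -- On the ball of radius ‖w₀‖ + 1 about w₀ the speed is at most (2‖w₀‖ + 1)/2 ≤ ‖w₀‖ + 1, so the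
  -- solution cannot leave the ball before time 1.
  have hpl : IsPicardLindelof (fun t w ↦ w * A (z₀ + t • y) y)
      (⟨0, by simp⟩ : Set.Icc (0 : ℝ) 1) w₀ (‖w₀‖₊ + 1) 0 (‖w₀‖₊ + 1) (1 / 2) := by
    refine ⟨fun t ht ↦ ?_, fun w _ ↦ ?_, fun t ht w hw ↦ ?_, ?_⟩
    · refine (LipschitzWith.of_dist_le_mul fun u v ↦ ?_).lipschitzOnWith
      rw [dist_eq_norm, dist_eq_norm, ← sub_mul, mul_comm (_ : ℝ)]
      exact (norm_mul_le _ _).trans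
        (mul_le_mul_of_nonneg_left (by simpa using hAy t ht) (norm_nonneg _))
    · have h1 : ContinuousOn (fun t : ℝ ↦ A (z₀ + t • y)) (Set.Icc 0 1) :=
        hA.comp (by fun_prop) hmem
      exact continuousOn_const.mul (h1.clm_apply continuousOn_const)
    · have hw' : ‖w‖ ≤ ‖w₀‖ + (‖w₀‖ + 1) := by
        have := norm_le_norm_add_norm_sub' w w₀
        rw [mem_closedBall_iff_norm] at hw
        push_cast at hw
        linarith
      calc ‖w * A (z₀ + t • y) y‖ ≤ ‖w‖ * ‖A (z₀ + t • y) y‖ := norm_mul_le _ _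
        _ ≤ (‖w₀‖ + (‖w₀‖ + 1)) * (1 / 2) :=
          mul_le_mul hw' (hAy t ht) (norm_nonneg _) (by positivity)
        _ ≤ _ := by push_cast; linarith
    · simp
  exact hpl.exists_eq_forall_mem_Icc_hasDerivWithinAt₀

/-- A solution of a differential inequality `‖d'‖ ≤ ‖d‖ + ε` on `[0, 1]` with `d 0 = 0`. -/
lemma norm_le_two_mul_of_norm_deriv_le {W : Type*} [NormedAddCommGroup W] [NormedSpace ℝ W]
    {d d' : ℝ → W} {ε : ℝ} (hε : 0 ≤ ε)
    (hd : ∀ t ∈ Set.Icc (0 : ℝ) 1, HasDerivWithinAt d (d' t) (Set.Icc 0 1) t) (h0 : d 0 = 0)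
    (hb : ∀ t ∈ Set.Icc (0 : ℝ) 1, ‖d' t‖ ≤ ‖d t‖ + ε) : ‖d 1‖ ≤ 2 * ε := by
  have h := norm_le_gronwallBound_of_norm_deriv_right_le (f := d) (f' := d') (δ := 0) (K := 1)
    (ε := ε) (a := 0) (b := 1) (fun t ht ↦ (hd t ht).continuousWithinAt)
    (fun t ht ↦ (hd t ⟨ht.1, ht.2.le⟩).mono_of_mem_nhdsWithin
      (Icc_mem_nhdsGE_of_mem ht)) (by simp [h0])
    (fun t ht ↦ by simpa using hb t ⟨ht.1, ht.2.le⟩) 1 (by simp)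
  rw [gronwallBound_of_K_ne_0 one_ne_zero] at h
  have he : Real.exp 1 - 1 ≤ 2 := by linarith [Real.exp_one_lt_d9]
  calc ‖d 1‖ ≤ _ := h
    _ = (Real.exp 1 - 1) * ε := by simp; ring
    _ ≤ 2 * ε := mul_le_mul_of_nonneg_right he hε

/-- If a solution w of dw = w A exists and g(t) = w(z₀ + t y), then w(z₀ + t (y + h)) is g(t) + t
g(t) A(z₀ + t y) h to first order in h. This curve is the candidate to compare with the true radial
solution in direction y + h. -/
lemma hasDerivWithinAt_first_order_variation {A : E → E →L[ℝ] R} {z₀ y : E} {g : ℝ → R}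
    {D : E →L[ℝ] E →L[ℝ] R} {s : Set ℝ} {t : ℝ} (h : E)
    (hA : HasFDerivAt A D (z₀ + t • y))
    (hg : HasDerivWithinAt g (g t * A (z₀ + t • y) y) s t) :
    HasDerivWithinAt (fun t ↦ g t + t • (g t * A (z₀ + t • y) h))
      (g t * A (z₀ + t • y) y + (g t * A (z₀ + t • y) h
        + t • (g t * D y h + g t * A (z₀ + t • y) y * A (z₀ + t • y) h))) s t := by
  have h1 : HasDerivAt (fun t : ℝ ↦ z₀ + t • y) y t := by
    simpa using ((hasDerivAt_id t).smul_const y).const_add z₀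
  have h2 : HasDerivAt (fun t : ℝ ↦ A (z₀ + t • y)) (D y) t := hA.comp_hasDerivAt t h1
  have h3 : HasDerivWithinAt (fun t : ℝ ↦ A (z₀ + t • y) h) (D y h) s t := by
    simpa using (h2.clm_apply (hasDerivAt_const t h)).hasDerivWithinAt
  have h4 := (hasDerivWithinAt_id t s).smul (hg.mul h3)
  have h5 := hg.add h4
  convert! h5 using 1
  simp
  abel_nf

/-- Expansion of the defect of the first order variation for a curvature free `A`. -/
lemma first_order_variation_defect {a a' : E →L[ℝ] R} {D : E →L[ℝ] E →L[ℝ] R}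
    {y h : E} (hflat : D y h - D h y + a y * a h - a h * a y = 0) (t : ℝ) (g : R) :
    (g + t • (g * a h)) * a' (y + h) - (g * a y + (g * a h + t • (g * D y h + g * a y * a h)))
      = t • ((g + t • (g * a h)) * D h h) + t • ((g * a h) * a h)
        + t • t • ((g * a h) * D h y)
        + (g + t • (g * a h)) * (a' - a - D (t • h)) (y + h) := by
  -- Flatness is used here only: it trades the derivative along the ray for the derivative along h
  -- plus a commutator, after which all terms of first order in h cancel.
  have h2 : D y h = D h y - a y * a h + a h * a y := by
    rw [← sub_eq_zero, ← hflat]; abel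
  rw [h2]
  simp only [sub_apply, map_add, map_smul, smul_apply, add_mul, mul_add, mul_sub,
    smul_mul_assoc, mul_smul_comm, mul_assoc, smul_add, smul_sub]
  module

/-- Each of the four terms of the defect contains h twice, the last one through the Taylor remainder
ρ. The condition C‖h‖ ≤ 1 only serves to bound the varied curve by 2B. -/
lemma norm_first_order_variation_defect_le {a ρ : E →L[ℝ] R}
    {D : E →L[ℝ] E →L[ℝ] R} {y h : E} {t r B C : ℝ} {g : R} (ht : t ∈ Set.Icc (0 : ℝ) 1)
    (ha : ‖a‖ ≤ C) (hD : ‖D‖ ≤ C) (hρ : ‖ρ‖ ≤ C * ‖h‖ ^ 2) (hy : ‖y‖ ≤ r) (hyh : ‖y + h‖ ≤ r)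
    (hh : C * ‖h‖ ≤ 1) (hg : ‖g‖ ≤ B) :
    ‖t • ((g + t • (g * a h)) * D h h) + t • ((g * a h) * a h)
        + t • t • ((g * a h) * D h y) + (g + t • (g * a h)) * ρ (y + h)‖
      ≤ (2 * C * B + C * C * B + C * C * r * B + 2 * C * r * B) * ‖h‖ ^ 2 := by
  have hC : 0 ≤ C := (norm_nonneg _).trans ha
  have hB : 0 ≤ B := (norm_nonneg _).trans hg
  have hr : 0 ≤ r := (norm_nonneg _).trans hy
  have hn := norm_nonneg h
  have ht' : ∀ v : R, ‖t • v‖ ≤ ‖v‖ := by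
    intro v
    rw [norm_smul, Real.norm_of_nonneg ht.1]
    exact mul_le_of_le_one_left (norm_nonneg _) ht.2
  have hm : ∀ {u v : R} {b c : ℝ}, ‖u‖ ≤ b → ‖v‖ ≤ c → 0 ≤ b → ‖u * v‖ ≤ b * c :=
    fun hu hv hb ↦ (norm_mul_le _ _).trans (mul_le_mul hu hv (norm_nonneg _) hb)
  have hah : ‖a h‖ ≤ C * ‖h‖ := ContinuousLinearMap.le_of_opNorm_le_of_le a ha le_rfl
  have hag : ‖g * a h‖ ≤ B * (C * ‖h‖) := hm hg hah hB
  have hw : ‖g + t • (g * a h)‖ ≤ 2 * B := by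
    have h1 := norm_add_le g (t • (g * a h))
    have h2 := ht' (g * a h)
    have h3 : B * (C * ‖h‖) ≤ B * 1 := mul_le_mul_of_nonneg_left hh hB
    linarith
  have hDh : ∀ {v : E} {c : ℝ}, ‖v‖ ≤ c → ‖D h v‖ ≤ C * ‖h‖ * c := fun hv ↦
    ContinuousLinearMap.le_of_opNorm_le_of_le (D h)
      (ContinuousLinearMap.le_of_opNorm_le_of_le D hD le_rfl) hv
  have b1 : ‖t • ((g + t • (g * a h)) * D h h)‖ ≤ 2 * B * (C * ‖h‖ * ‖h‖) :=
    (ht' _).trans (hm hw (hDh le_rfl) (by positivity))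
  have b2 : ‖t • ((g * a h) * a h)‖ ≤ B * (C * ‖h‖) * (C * ‖h‖) :=
    (ht' _).trans (hm hag hah (by positivity))
  have b3 : ‖t • t • ((g * a h) * D h y)‖ ≤ B * (C * ‖h‖) * (C * ‖h‖ * r) :=
    (ht' _).trans ((ht' _).trans (hm hag (hDh hy) (by positivity)))
  have b4 : ‖(g + t • (g * a h)) * ρ (y + h)‖ ≤ 2 * B * (C * ‖h‖ ^ 2 * r) :=
    hm hw (ContinuousLinearMap.le_of_opNorm_le_of_le ρ hρ hyh) (by positivity)
  calc _ ≤ _ := norm_add₄_le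
    _ ≤ 2 * B * (C * ‖h‖ * ‖h‖) + B * (C * ‖h‖) * (C * ‖h‖) + B * (C * ‖h‖) * (C * ‖h‖ * r)
        + 2 * B * (C * ‖h‖ ^ 2 * r) := by gcongr
    _ = _ := by ring

/-- Uniform estimates on a small ball for a `C²` map. -/
lemma exists_ball_taylor_bound {F : Type*} [NormedAddCommGroup F] [NormedSpace ℝ F]
    {A : E → F} {z₀ : E} {U : Set E} (hU : U ∈ 𝓝 z₀) (hA : ContDiffAt ℝ 2 A z₀) :
    ∃ r > 0, ∃ C > 0, C * r ≤ 1 / 2 ∧ Metric.ball z₀ r ⊆ U ∧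
      (∀ z ∈ Metric.ball z₀ r, DifferentiableAt ℝ A z) ∧
      (∀ z ∈ Metric.ball z₀ r, ‖A z‖ ≤ C) ∧ (∀ z ∈ Metric.ball z₀ r, ‖fderiv ℝ A z‖ ≤ C) ∧
      ∀ z ∈ Metric.ball z₀ r, ∀ k, z + k ∈ Metric.ball z₀ r →
        ‖A (z + k) - A z - fderiv ℝ A z k‖ ≤ C * ‖k‖ ^ 2 := by
  have hdiff : ∀ᶠ z in 𝓝 z₀, DifferentiableAt ℝ A z := by
    filter_upwards [hA.eventually (by simp)] with z hz using hz.differentiableAt (by simp)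
  have hD1 : ContDiffAt ℝ 1 (fderiv ℝ A) z₀ := hA.fderiv_right (by norm_num)
  obtain ⟨K, T, hT, hK⟩ := hD1.exists_lipschitzOnWith
  have hAb : ∀ᶠ z in 𝓝 z₀, ‖A z‖ < ‖A z₀‖ + 1 :=
    hA.continuousAt.norm.eventually_lt_const (by simp)
  have hDb : ∀ᶠ z in 𝓝 z₀, ‖fderiv ℝ A z‖ < ‖fderiv ℝ A z₀‖ + 1 :=
    hD1.continuousAt.norm.eventually_lt_const (by simp)
  obtain ⟨ρ, hρ, hρs⟩ := Metric.eventually_nhds_iff_ball.1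
    (hdiff.and ((Filter.Eventually.and hU hT).and (hAb.and hDb)))
  -- One constant dominates A, its derivative and the Lipschitz constant of the derivative;
  -- shrinking r afterwards gives C r ≤ 1/2 without changing C.
  let C : ℝ := (‖A z₀‖ + 1) + (‖fderiv ℝ A z₀‖ + 1) + K
  have hK0 : (0 : ℝ) ≤ K := K.2
  have hA0 := norm_nonneg (A z₀)
  have hD0 := norm_nonneg (fderiv ℝ A z₀)
  have hC0 : 0 < C := by positivity
  let r := min ρ (1 / (2 * C))
  have hr0 : 0 < r := lt_min hρ (by positivity)
  have hrC : C * r ≤ 1 / 2 := by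
    calc C * r ≤ C * (1 / (2 * C)) := mul_le_mul_of_nonneg_left (min_le_right _ _) hC0.le
      _ = 1 / 2 := by field_simp
  have hrρ : Metric.ball z₀ r ⊆ Metric.ball z₀ ρ := Metric.ball_subset_ball (min_le_left _ _)
  have hAdiff : ∀ z ∈ Metric.ball z₀ r, DifferentiableAt ℝ A z := fun z hz ↦ (hρs z (hrρ hz)).1
  have hDL : ∀ z ∈ Metric.ball z₀ r, ∀ z' ∈ Metric.ball z₀ r,
      ‖fderiv ℝ A z' - fderiv ℝ A z‖ ≤ C * ‖z' - z‖ := fun z hz z' hz' ↦ by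
    refine (hK.norm_sub_le (hρs z' (hrρ hz')).2.1.2 (hρs z (hrρ hz)).2.1.2).trans ?_
    refine mul_le_mul_of_nonneg_right ?_ (norm_nonneg _)
    simp only [C]; linarith
  refine ⟨r, hr0, C, hC0, hrC, fun z hz ↦ (hρs z (hrρ hz)).2.1.1, hAdiff, fun z hz ↦ ?_,
    fun z hz ↦ ?_, fun z hz k hk ↦ ?_⟩
  · have := (hρs z (hrρ hz)).2.2.1
    simp only [C]; linarith
  · have := (hρs z (hrρ hz)).2.2.2
    simp only [C]; linarith
  · have hseg : segment ℝ z (z + k) ⊆ Metric.ball z₀ r := (convex_ball z₀ r).segment_subset hz hk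
    have := Convex.norm_image_sub_le_of_norm_hasFDerivWithin_le' (𝕜 := ℝ) (f := A)
      (f' := fderiv ℝ A) (φ := fderiv ℝ A z) (C := C * ‖k‖) (s := segment ℝ z (z + k))
      (fun x hx ↦ (hAdiff x (hseg hx)).hasFDerivAt.hasFDerivWithinAt)
      (fun x hx ↦ (hDL z hz x (hseg hx)).trans (by
        refine mul_le_mul_of_nonneg_left ?_ hC0.le
        simpa using norm_sub_le_of_mem_segment hx))
      (convex_segment _ _) (left_mem_segment ℝ _ _) (right_mem_segment ℝ _ _)
    rw [add_sub_cancel_left] at this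
    exact this.trans_eq (by ring)

/-- **Frobenius theorem for linear total differential equations** `dw = w * A` with vanishing
curvature. -/
theorem exists_hasFDerivAt_of_flat [CompleteSpace R] {A : E → E →L[ℝ] R} {z₀ : E}
    {U : Set E} (hU : U ∈ 𝓝 z₀) (hA : ContDiffAt ℝ 2 A z₀)
    (hflat : ∀ z ∈ U, ∀ u v, fderiv ℝ A z u v - fderiv ℝ A z v u + A z u * A z v
      - A z v * A z u = 0) (w₀ : R) :
    ∃ r > 0, Metric.ball z₀ r ⊆ U ∧ ∃ w : E → R, w z₀ = w₀ ∧
      ∀ z ∈ Metric.ball z₀ r,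
        HasFDerivAt w ((ContinuousLinearMap.mul ℝ R (w z)).comp (A z)) z := by
  obtain ⟨r, hr0, C, hC0, hrC, hrU, hAdiff, hAC, hDC, hTaylor⟩ := exists_ball_taylor_bound hU hA
  have hAcont : ContinuousOn A (Metric.ball z₀ r) :=
    fun z hz ↦ (hAdiff z hz).continuousAt.continuousWithinAt
  have hsol : ∀ y ∈ Metric.ball (0 : E) r, ∃ g : ℝ → R, g 0 = w₀ ∧ ∀ t ∈ Set.Icc (0 : ℝ) 1,
      HasDerivWithinAt g (g t * A (z₀ + t • y) y) (Set.Icc 0 1) t := fun y hy ↦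
    exists_radial_solution hAcont hAC hrC w₀ (mem_ball_zero_iff.1 hy)
  choose! G hG0 hG using hsol
  have hmem : ∀ y ∈ Metric.ball (0 : E) r, ∀ t ∈ Set.Icc (0 : ℝ) 1,
      z₀ + t • y ∈ Metric.ball z₀ r := by
    intro y hy t ht
    rw [mem_ball_zero_iff] at hy
    rw [mem_ball_iff_norm, add_sub_cancel_left, norm_smul, Real.norm_of_nonneg ht.1]
    nlinarith [norm_nonneg y, ht.2]
  have hAy : ∀ y ∈ Metric.ball (0 : E) r, ∀ t ∈ Set.Icc (0 : ℝ) 1,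
      ‖A (z₀ + t • y) y‖ ≤ 1 := by
    intro y hy t ht
    have h1 : ‖A (z₀ + t • y) y‖ ≤ C * r := ContinuousLinearMap.le_of_opNorm_le_of_le _
      (hAC _ (hmem y hy t ht)) (mem_ball_zero_iff.1 hy).le
    linarith
  refine ⟨r, hr0, hrU, fun z ↦ G (z - z₀) 1, ?_, fun z hz ↦ ?_⟩
  · have h0 : (0 : E) ∈ Metric.ball (0 : E) r := Metric.mem_ball_self hr0
    -- On the degenerate ray y = 0 the equation reads g' = 0, and the Grönwall estimate with ε = 0
    -- gives g(1) = w₀.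
    have h1 := norm_le_two_mul_of_norm_deriv_le (d := fun t ↦ G 0 t - w₀) (ε := 0) le_rfl
      (fun t ht ↦ (hG 0 h0 t ht).sub_const w₀) (by simp [hG0 0 h0]) (fun t ht ↦ by simp)
    simpa [sub_eq_zero] using h1
  · obtain ⟨y, rfl⟩ : ∃ y, z = z₀ + y := ⟨z - z₀, by abel⟩
    have hy : y ∈ Metric.ball (0 : E) r := by simpa using hz
    obtain ⟨B, hB⟩ := isCompact_Icc.exists_bound_of_continuousOn (f := G y) (s := Set.Icc (0 : ℝ) 1)
      (fun t ht ↦ (hG y hy t ht).continuousWithinAt)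
    have hB0 : 0 ≤ B := (norm_nonneg _).trans (hB 0 (by simp))
    let N := 2 * C * B + C * C * B + C * C * r * B + 2 * C * r * B
    have hN : 0 ≤ N := by positivity
    -- The first order variation at t = 1 is G y 1 + G y 1 A(z₀ + y) h, so a quadratic error here is
    -- differentiability with the required derivative.
    have key : ∀ h : E, y + h ∈ Metric.ball (0 : E) r →
        ‖G (y + h) 1 - G y 1 - G y 1 * A (z₀ + y) h‖ ≤ 2 * (N * ‖h‖ ^ 2) := by
      intro h hyh
      have hh : C * ‖h‖ ≤ 1 := by
        have h1 : ‖h‖ ≤ ‖y + h‖ + ‖y‖ := by simpa using norm_sub_le (y + h) y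
        rw [mem_ball_zero_iff] at hy hyh
        calc C * ‖h‖ ≤ C * (r + r) := mul_le_mul_of_nonneg_left (by linarith) hC0.le
          _ ≤ 1 := by linarith
      have hd := fun t ht ↦ (hG (y + h) hyh t ht).sub (hasDerivWithinAt_first_order_variation h
          (hAdiff _ (hmem y hy t ht)).hasFDerivAt (hG y hy t ht))
      have := norm_le_two_mul_of_norm_deriv_le (by positivity : 0 ≤ N * ‖h‖ ^ 2) hd
        (by simp [hG0 y hy, hG0 _ hyh]) (fun t ht ↦ ?_)
      · simpa [sub_sub] using this
      · have hz' := hmem y hy t ht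
        have e := first_order_variation_defect (a := A (z₀ + t • y)) (a' := A (z₀ + t • (y + h)))
          (hflat _ (hrU hz') y h) t (G y t)
        have hk : z₀ + t • (y + h) = z₀ + t • y + t • h := by rw [smul_add, add_assoc]
        have hρ' : ‖A (z₀ + t • (y + h)) - A (z₀ + t • y) - fderiv ℝ A (z₀ + t • y) (t • h)‖
            ≤ C * ‖h‖ ^ 2 := by
          have h1 := hTaylor _ hz' (t • h) (hk ▸ hmem _ hyh t ht)
          rw [← hk] at h1
          refine h1.trans ?_
          have : ‖t • h‖ ≤ ‖h‖ := by
            rw [norm_smul, Real.norm_of_nonneg ht.1]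
            exact mul_le_of_le_one_left (norm_nonneg _) ht.2
          gcongr
        have hb := norm_first_order_variation_defect_le ht (hAC _ hz') (hDC _ hz') hρ'
          (mem_ball_zero_iff.1 hy).le (mem_ball_zero_iff.1 hyh).le hh (hB t ht)
        rw [← e] at hb
        set w := G y t + t • (G y t * A (z₀ + t • y) h) with hw
        -- With p the coefficient of the ray y + h and q the derivative of the varied curve, the
        -- first summand is controlled by the difference itself, since ‖p‖ ≤ 1, and the second is
        -- the quadratic defect: this is the form ‖d'‖ ≤ ‖d‖ + ε.
        have hsplit : ∀ p q : R, G (y + h) t * p - q = (G (y + h) t - w) * p + (w * p - q) := by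
          intro p q; rw [sub_mul]; abel
        rw [hsplit]
        refine (norm_add_le _ _).trans (add_le_add ?_ hb)
        refine (norm_mul_le _ _).trans (mul_le_of_le_one_right (norm_nonneg _) (hAy _ hyh t ht))
    rw [hasFDerivAt_iff_isLittleO_nhds_zero]
    have hO : (fun h : E ↦ G (z₀ + y + h - z₀) 1 - G (z₀ + y - z₀) 1
        - ((ContinuousLinearMap.mul ℝ R (G (z₀ + y - z₀) 1)).comp (A (z₀ + y))) h)
        =O[𝓝 0] fun h ↦ ‖h‖ ^ 2 := by
      refine Asymptotics.IsBigO.of_bound (2 * N) ?_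
      have : ∀ᶠ h : E in 𝓝 0, y + h ∈ Metric.ball (0 : E) r := by
        have hc : ContinuousAt (fun h : E ↦ y + h) 0 := by fun_prop
        exact hc.eventually_mem (Metric.isOpen_ball.mem_nhds (by simpa using hy))
      filter_upwards [this] with h hh
      have := key h hh
      rw [add_assoc, add_sub_cancel_left, add_sub_cancel_left]
      simpa [mul_assoc] using this
    exact hO.trans_isLittleO (Asymptotics.isLittleO_norm_pow_id one_lt_two)

/-- Solutions of `dw = w * A` on a ball are determined by their value at the centre. -/
lemma eqOn_zero_of_hasFDerivAt {A : E → E →L[ℝ] R} {z₀ : E} {r : ℝ}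
    (hA : ContinuousOn A (Metric.ball z₀ r)) {w : E → R} (h0 : w z₀ = 0)
    (hw : ∀ z ∈ Metric.ball z₀ r,
      HasFDerivAt w ((ContinuousLinearMap.mul ℝ R (w z)).comp (A z)) z) :
    ∀ z ∈ Metric.ball z₀ r, w z = 0 := by
  intro z hz
  obtain ⟨y, rfl⟩ : ∃ y, z = z₀ + y := ⟨z - z₀, by abel⟩
  have hmem : ∀ t ∈ Set.Icc (0 : ℝ) 1, z₀ + t • y ∈ Metric.ball z₀ r := by
    intro t ht
    have hy : ‖y‖ < r := by simpa using hz
    rw [mem_ball_iff_norm, add_sub_cancel_left, norm_smul, Real.norm_of_nonneg ht.1]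
    nlinarith [norm_nonneg y, ht.2]
  have hcont : ContinuousOn (fun t : ℝ ↦ A (z₀ + t • y) y) (Set.Icc 0 1) :=
    (hA.comp (by fun_prop) hmem).clm_apply continuousOn_const
  obtain ⟨B, hB⟩ := isCompact_Icc.exists_bound_of_continuousOn hcont
  have hd : ∀ t ∈ Set.Icc (0 : ℝ) 1,
      HasDerivAt (fun t : ℝ ↦ w (z₀ + t • y)) (w (z₀ + t • y) * A (z₀ + t • y) y) t := by
    intro t ht
    have h1 : HasDerivAt (fun t : ℝ ↦ z₀ + t • y) y t := by
      simpa using ((hasDerivAt_id t).smul_const y).const_add z₀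
    exact (hw _ (hmem t ht)).comp_hasDerivAt t h1
  -- Along each ray the equation is a linear ordinary differential equation with zero initial value.
  have := eq_zero_of_abs_deriv_le_mul_abs_self_of_eq_zero_right (K := B)
    (fun t ht ↦ (hd t ht).continuousAt.continuousWithinAt)
    (fun t ht ↦ (hd t ⟨ht.1, ht.2.le⟩).hasDerivWithinAt) (by simpa using h0)
    (fun t ht ↦ by
      rw [mul_comm B]
      exact (norm_mul_le _ _).trans
        (mul_le_mul_of_nonneg_left (hB t ⟨ht.1, ht.2.le⟩) (norm_nonneg _))) 1 (by simp)
  simpa using this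

/-- Bootstrapping: the derivative w A is as regular as w, so w gains one order at each step. -/
lemma contDiffOn_of_hasFDerivAt_mul {A : E → E →L[ℝ] R} {s : Set E} (hs : IsOpen s)
    (hA : ContDiffOn ℝ ∞ A s) {w : E → R}
    (hw : ∀ z ∈ s, HasFDerivAt w ((ContinuousLinearMap.mul ℝ R (w z)).comp (A z)) z) :
    ContDiffOn ℝ ∞ w s := by
  rw [contDiffOn_infty]
  intro n
  induction n with
  | zero =>
    exact contDiffOn_zero.2 fun z hz ↦ (hw z hz).continuousAt.continuousWithinAt
  | succ n ih =>
    push_cast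
    rw [contDiffOn_succ_iff_fderiv_of_isOpen hs]
    refine ⟨fun z hz ↦ (hw z hz).differentiableAt.differentiableWithinAt, by simp, ?_⟩
    refine ContDiffOn.congr (f := fun z ↦ (ContinuousLinearMap.mul ℝ R (w z)).comp (A z)) ?_
      fun z hz ↦ (hw z hz).fderiv
    exact ((ContinuousLinearMap.mul ℝ R).contDiff.comp_contDiffOn ih).clm_comp
      (hA.of_le (mod_cast le_top))

end TotalDifferentialEquation

/-! ### Flat coordinates of a symmetric flat connection form. -/

section FlatCoordinates

variable {E : Type*} [NormedAddCommGroup E] [NormedSpace ℝ E]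

/-- A `C^∞` map between Banach spaces with everywhere invertible derivative on a neighbourhood of a
point restricts to a local diffeomorphism. -/
lemma exists_openPartialHomeomorph_of_isUnit [CompleteSpace E] {f : E → E} {θ : E → E →L[ℝ] E}
    {V : Set E} (hV : IsOpen V) {z₀ : E} (hz₀ : z₀ ∈ V) (hf : ContDiffOn ℝ ∞ f V)
    (hθ : ∀ z ∈ V, HasFDerivAt f (θ z) z) (hu : ∀ z ∈ V, IsUnit (θ z)) :
    ∃ φ : OpenPartialHomeomorph E E, z₀ ∈ φ.source ∧ φ.source ⊆ V ∧ ⇑φ = f ∧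
      ContDiffOn ℝ ∞ φ.symm φ.target := by
  have he : ∀ z ∈ V, ∃ e : E ≃L[ℝ] E, HasFDerivAt f (e : E →L[ℝ] E) z := fun z hz ↦ by
    obtain ⟨u, h⟩ := hu z hz
    refine ⟨ContinuousLinearEquiv.ofUnit u, ?_⟩
    exact (hθ z hz).congr_fderiv h.symm
  have hfz : ∀ z ∈ V, ContDiffAt ℝ ∞ f z := fun z hz ↦ hf.contDiffAt (hV.mem_nhds hz)
  obtain ⟨e₀, he₀⟩ := he z₀ hz₀
  let φ := (hfz z₀ hz₀).toOpenPartialHomeomorph f he₀ (by simp)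
  have hφ : ⇑φ = f := rfl
  -- The inverse function theorem at z₀ does not by itself place the source in V; cutting down to V
  -- makes the derivative invertible at every point of the source, so the inverse is smooth on the
  -- whole target.
  refine ⟨φ.restrOpen V hV, ?_, ?_, hφ, ?_⟩
  · exact ⟨(hfz z₀ hz₀).mem_toOpenPartialHomeomorph_source he₀ (by simp), hz₀⟩
  · exact fun z hz ↦ hz.2
  · intro a ha
    have hs : (φ.restrOpen V hV).symm a ∈ V := ((φ.restrOpen V hV).map_target ha).2
    obtain ⟨e, he⟩ := he _ hs
    exact (OpenPartialHomeomorph.contDiffAt_symm (φ.restrOpen V hV) ha he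
      (hfz _ hs)).contDiffWithinAt

set_option synthInstance.maxHeartbeats 200000 in
/-- A symmetric flat connection form `Γ` on an open subset of `E` admits flat coordinates; the
derivative of these coordinates intertwines every parallel field of endomorphisms with its value at
the base point. -/
theorem exists_flat_coordinates [CompleteSpace E] {Γ : E → E →L[ℝ] E →L[ℝ] E} {U : Set E}
    (hU : IsOpen U) {z₀ : E} (hz₀ : z₀ ∈ U) (hΓ : ContDiffOn ℝ ∞ Γ U)
    (hsymm : ∀ z ∈ U, ∀ u v, Γ z u v = Γ z v u)
    (hflat : ∀ z ∈ U, ∀ u v, fderiv ℝ Γ z u v - fderiv ℝ Γ z v u + Γ z u * Γ z v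
      - Γ z v * Γ z u = 0) :
    ∃ φ : OpenPartialHomeomorph E E, z₀ ∈ φ.source ∧ φ.source ⊆ U ∧
      ContDiffOn ℝ ∞ φ φ.source ∧ ContDiffOn ℝ ∞ φ.symm φ.target ∧ fderiv ℝ φ z₀ = 1 ∧
      ∀ K : E → E →L[ℝ] E, (∀ z ∈ U, DifferentiableAt ℝ K z) →
        (∀ z ∈ U, ∀ u, fderiv ℝ K z u + Γ z u * K z = K z * Γ z u) →
        ∀ z ∈ φ.source, fderiv ℝ φ z * K z = K z₀ * fderiv ℝ φ z := by
  -- The algebra is that of endomorphisms of E, with composition as product, and the initial value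
  -- is the identity.
  obtain ⟨r, hr, hrU, θ, hθ0, hθ⟩ := exists_hasFDerivAt_of_flat (hU.mem_nhds hz₀)
    ((hΓ.contDiffAt (hU.mem_nhds hz₀)).of_le (ENat.LEInfty.out)) hflat (1 : E →L[ℝ] E)
  have hb : IsOpen (Metric.ball z₀ r) := Metric.isOpen_ball
  have hΓr : ContDiffOn ℝ ∞ Γ (Metric.ball z₀ r) := hΓ.mono hrU
  have hθs : ContDiffOn ℝ ∞ θ (Metric.ball z₀ r) := contDiffOn_of_hasFDerivAt_mul hb hΓr hθ
  -- The derivative of θ is (u, v) ↦ θ(Γ(u) v), symmetric because Γ is. By the Poincaré lemma on the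
  -- ball, θ is the derivative of some f.
  obtain ⟨f, hf⟩ := (convex_ball z₀ r).exists_forall_hasFDerivAt_of_fderiv_symmetric (𝕜 := ℝ) hb
    (fun z hz ↦ (hθ z hz).differentiableAt.differentiableWithinAt) (fun z hz x y ↦ by
      rw [(hθ z hz).fderiv]
      simp [hsymm z (hrU hz) x y])
  have hfs : ContDiffOn ℝ ∞ f (Metric.ball z₀ r) := by
    rw [contDiffOn_infty_iff_fderiv_of_isOpen hb]
    exact ⟨fun z hz ↦ (hf z hz).differentiableAt.differentiableWithinAt,
      hθs.congr fun z hz ↦ (hf z hz).fderiv⟩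
  let V := Metric.ball z₀ r ∩ θ ⁻¹' {a | IsUnit a}
  have hV : IsOpen V := hθs.continuousOn.isOpen_inter_preimage hb Units.isOpen
  have hz₀r : z₀ ∈ Metric.ball z₀ r := Metric.mem_ball_self hr
  have hz₀V : z₀ ∈ V := ⟨hz₀r, by simp [hθ0]⟩
  obtain ⟨φ, h0, hφV, hφ, hφs⟩ := exists_openPartialHomeomorph_of_isUnit hV hz₀V
    (hfs.mono fun z hz ↦ hz.1) (fun z hz ↦ hf z hz.1) (fun z hz ↦ hz.2)
  refine ⟨φ, h0, fun z hz ↦ hrU (hφV hz).1, ?_, hφs, ?_, ?_⟩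
  · rw [hφ]
    exact hfs.mono fun z hz ↦ (hφV hz).1
  · rw [hφ, (hf z₀ hz₀r).fderiv, hθ0]
  · intro K hK hKΓ z hz
    -- For parallel K one has dK = KΓ - ΓK, hence d(θK - K(z₀)θ) = (θK - K(z₀)θ)Γ, with value 0 at
    -- z₀.
    have key := eqOn_zero_of_hasFDerivAt (A := Γ) (z₀ := z₀) (r := r) hΓr.continuousOn
      (w := fun z ↦ θ z * K z - K z₀ * θ z) (by simp [hθ0]) (fun z hz ↦ ?_) z (hφV hz).1
    · rw [hφ, (hf z (hφV hz).1).fderiv]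
      exact sub_eq_zero.1 key
    · have h1 := ((hθ z hz).mul' (hK z (hrU hz)).hasFDerivAt).sub ((hθ z hz).const_mul (K z₀))
      refine h1.congr_fderiv (ContinuousLinearMap.ext fun u ↦ ?_)
      have h2 := hKΓ z (hrU hz) u
      have h3 : fderiv ℝ K z u = K z * Γ z u - Γ z u * K z := eq_sub_of_add_eq h2
      simp [h3, mul_sub, mul_assoc]

end FlatCoordinates

/-! ### Vector fields in local coordinates. -/

section CoordinateFields

variable {E : Type*} [NormedAddCommGroup E] [NormedSpace ℝ E]
  {M : Type*} [TopologicalSpace M] [ChartedSpace E M]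
  {E' : Type*} [NormedAddCommGroup E'] [NormedSpace ℝ E']

variable (E) in
/-- Smooth local coordinates with values in a normed space. -/
structure IsSmoothChart (φ : OpenPartialHomeomorph M E') : Prop where
  contMDiffOn : ContMDiffOn 𝓘(ℝ, E) 𝓘(ℝ, E') ∞ φ φ.source
  contMDiffOn_symm : ContMDiffOn 𝓘(ℝ, E') 𝓘(ℝ, E) ∞ φ.symm φ.target

/-- The vector field on the domain of `φ` with coordinate expression `f`. -/
def ofCoord (φ : OpenPartialHomeomorph M E') (f : E' → E') : Π y : M, TangentSpace 𝓘(ℝ, E) y :=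
  mpullback 𝓘(ℝ, E) 𝓘(ℝ, E') φ f

lemma ofCoord_apply (φ : OpenPartialHomeomorph M E') (f : E' → E') (y : M) :
    ofCoord (E := E) φ f y = (mfderiv 𝓘(ℝ, E) 𝓘(ℝ, E') φ y).inverse (f (φ y)) := rfl

lemma ofCoord_congr {φ : OpenPartialHomeomorph M E'} {f g : E' → E'} {y : M}
    (h : f (φ y) = g (φ y)) : ofCoord (E := E) φ f y = ofCoord φ g y := by
  rw [ofCoord_apply, ofCoord_apply, h]

/-- The inverse of the derivative is a linear map at every point, zero by default where the
derivative is not invertible; so the linearity rules for `ofCoord` hold on all of M and need no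
smoothness of φ. -/
lemma ofCoord_add (φ : OpenPartialHomeomorph M E') (f g : E' → E') :
    ofCoord (E := E) φ (f + g) = ofCoord φ f + ofCoord φ g := mpullback_add

lemma ofCoord_sub (φ : OpenPartialHomeomorph M E') (f g : E' → E') (y : M) :
    ofCoord (E := E) φ (f - g) y = ofCoord φ f y - ofCoord φ g y := by
  simp only [ofCoord_apply]
  exact map_sub _ _ _

lemma ofCoord_const_smul (φ : OpenPartialHomeomorph M E') (c : ℝ) (f : E' → E') :
    ofCoord (E := E) φ (c • f) = c • ofCoord φ f := mpullback_const_smul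

lemma ofCoord_smul (φ : OpenPartialHomeomorph M E') (g : E' → ℝ) (f : E' → E') :
    ofCoord (E := E) φ (g • f) = (g ∘ φ) • ofCoord φ f := mpullback_smul

lemma ofCoord_sum (φ : OpenPartialHomeomorph M E') {ι : Type*} (s : Finset ι) (f : ι → E' → E') :
    ofCoord (E := E) φ (fun z ↦ ∑ i ∈ s, f i z) = ∑ i ∈ s, ofCoord φ (f i) := by
  funext x
  rw [Finset.sum_apply]
  exact map_sum ((mfderiv 𝓘(ℝ, E) 𝓘(ℝ, E') φ x).inverse) _ _

lemma ofCoord_zero (φ : OpenPartialHomeomorph M E') : ofCoord (E := E) φ 0 = 0 := mpullback_zero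

lemma mdiffAt_vectorSpace_of_differentiableAt {V : Π z : E', TangentSpace 𝓘(ℝ, E') z} {z : E'}
    (hf : DifferentiableAt ℝ (fun z ↦ (V z : E')) z) : MDiffAt (T% V) z := by
  apply (mdifferentiableAt_totalSpace _ _).2
  refine ⟨mdifferentiableAt_id, ?_⟩
  convert! hf.mdifferentiableAt with y
  simp

lemma mlieBracket_vectorSpace_eq_lieBracket {V W : Π z : E', TangentSpace 𝓘(ℝ, E') z} :
    mlieBracket 𝓘(ℝ, E') V W = lieBracket ℝ V W := by
  rw [← mlieBracketWithin_univ, mlieBracketWithin_eq_lieBracketWithin]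
  exact lieBracketWithin_univ

namespace IsSmoothChart

variable {φ : OpenPartialHomeomorph M E'} {y : M} (hφ : IsSmoothChart E φ)
include hφ

lemma mdifferentiable : φ.MDifferentiable 𝓘(ℝ, E) 𝓘(ℝ, E') :=
  ⟨hφ.contMDiffOn.mdifferentiableOn (by simp), hφ.contMDiffOn_symm.mdifferentiableOn (by simp)⟩

lemma contMDiffAt (hy : y ∈ φ.source) : ContMDiffAt 𝓘(ℝ, E) 𝓘(ℝ, E') ∞ φ y :=
  hφ.contMDiffOn.contMDiffAt (φ.open_source.mem_nhds hy)

lemma contMDiffAt_symm {z : E'} (hz : z ∈ φ.target) :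
    ContMDiffAt 𝓘(ℝ, E') 𝓘(ℝ, E) ∞ φ.symm z :=
  hφ.contMDiffOn_symm.contMDiffAt (φ.open_target.mem_nhds hz)

lemma mdiffAt (hy : y ∈ φ.source) : MDifferentiableAt 𝓘(ℝ, E) 𝓘(ℝ, E') φ y :=
  (hφ.contMDiffAt hy).mdifferentiableAt (by simp)

variable [FiniteDimensional ℝ E] [IsManifold 𝓘(ℝ, E) ∞ M]

lemma isInvertible_mfderiv (hy : y ∈ φ.source) :
    (mfderiv 𝓘(ℝ, E) 𝓘(ℝ, E') φ y).IsInvertible :=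
  ⟨hφ.mdifferentiable.mfderiv hy, rfl⟩

lemma isInvertible_mfderiv_symm (hy : y ∈ φ.source) :
    (mfderiv 𝓘(ℝ, E') 𝓘(ℝ, E) φ.symm (φ y)).IsInvertible :=
  ⟨hφ.mdifferentiable.symm.mfderiv (φ.map_source hy), rfl⟩

lemma mfderiv_ofCoord (hy : y ∈ φ.source) (f : E' → E') :
    mfderiv 𝓘(ℝ, E) 𝓘(ℝ, E') φ y (ofCoord φ f y) = f (φ y) :=
  (hφ.isInvertible_mfderiv hy).self_apply_inverse _

lemma eq_ofCoord_iff (hy : y ∈ φ.source) {f : E' → E'} {v : TangentSpace 𝓘(ℝ, E) y} :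
    v = ofCoord φ f y ↔ mfderiv 𝓘(ℝ, E) 𝓘(ℝ, E') φ y v = f (φ y) := by
  constructor
  · rintro rfl
    exact hφ.mfderiv_ofCoord hy f
  · intro h
    rw [ofCoord_apply, ← h]
    exact ((hφ.isInvertible_mfderiv hy).inverse_apply_self _).symm

lemma ofCoord_inj (hy : y ∈ φ.source) {f g : E' → E'} :
    ofCoord (E := E) φ f y = ofCoord φ g y ↔ f (φ y) = g (φ y) := by
  exact (hφ.eq_ofCoord_iff hy).trans (by rw [hφ.mfderiv_ofCoord hy]; exact Iff.rfl)

lemma contMDiffAt_ofCoord (hy : y ∈ φ.source) {f : E' → E'} (hf : ContDiffAt ℝ ∞ f (φ y)) :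
    CMDiffAt ∞ (T% (ofCoord (E := E) φ f)) y := by
  refine ContMDiffAt.mpullback_vectorField_preimage (n := ∞) ?_ (hφ.contMDiffAt hy)
    (hφ.isInvertible_mfderiv hy) (by simp)
  exact contMDiffAt_vectorSpace_iff_contDiffAt.2 hf

lemma mdiffAt_ofCoord (hy : y ∈ φ.source) {f : E' → E'} (hf : DifferentiableAt ℝ f (φ y)) :
    MDiffAt (T% (ofCoord (E := E) φ f)) y := by
  refine MDifferentiableAt.mpullback_vectorField (n := ∞) ?_ (hφ.contMDiffAt hy)
    (hφ.isInvertible_mfderiv hy) ENat.LEInfty.out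
  exact mdiffAt_vectorSpace_of_differentiableAt hf

/-- The coordinate expression is the pullback of X by the inverse chart. Smoothness is transferred
point by point, so fields smooth only near one point are covered. -/
lemma exists_eq_ofCoord [FiniteDimensional ℝ E'] (X : Π y : M, TangentSpace 𝓘(ℝ, E) y) :
    ∃ f : E' → E', (∀ y ∈ φ.source, X y = ofCoord φ f y) ∧
    ∀ y ∈ φ.source, CMDiffAt ∞ (T% X) y → ContDiffAt ℝ ∞ f (φ y) := by
  refine ⟨fun z ↦ mpullback 𝓘(ℝ, E') 𝓘(ℝ, E) φ.symm X z, fun y hy ↦ ?_, fun y hy hX ↦ ?_⟩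
  · refine (hφ.eq_ofCoord_iff hy).2 ?_
    refine ((hφ.isInvertible_mfderiv_symm hy).inverse_apply_eq.2 ?_).symm
    have h1 := congrArg (fun L ↦ L (X y)) (hφ.mdifferentiable.symm_comp_deriv hy)
    rw [φ.left_inv hy]
    exact h1.symm
  · refine contMDiffAt_vectorSpace_iff_contDiffAt.1
      (ContMDiffAt.mpullback_vectorField_preimage (n := ∞) ?_
        (hφ.contMDiffAt_symm (φ.map_source hy)) (hφ.isInvertible_mfderiv_symm hy) (by simp))
    rwa [φ.left_inv hy]

/-- Pullback by a local diffeomorphism commutes with brackets. In particular fields with constant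
coordinate expression commute. -/
lemma mlieBracket_ofCoord [FiniteDimensional ℝ E'] (hy : y ∈ φ.source) {f g : E' → E'}
    (hf : DifferentiableAt ℝ f (φ y)) (hg : DifferentiableAt ℝ g (φ y)) :
    mlieBracket 𝓘(ℝ, E) (ofCoord φ f) (ofCoord φ g) y
      = ofCoord φ (fun z ↦ fderiv ℝ g z (f z) - fderiv ℝ f z (g z)) y := by
  have h1 : IsManifold 𝓘(ℝ, E) (minSmoothness ℝ 2) M := by
    rw [minSmoothness_of_isRCLikeNormedField]; infer_instance
  have h := mpullback_mlieBracket (n := ∞) (mdiffAt_vectorSpace_of_differentiableAt hf)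
    (mdiffAt_vectorSpace_of_differentiableAt hg) (hφ.contMDiffAt hy)
    (by rw [minSmoothness_of_isRCLikeNormedField]; exact ENat.LEInfty.out)
  refine h.symm.trans (ofCoord_congr ?_)
  exact congrFun mlieBracket_vectorSpace_eq_lieBracket _

lemma mvfderiv_comp_ofCoord (hy : y ∈ φ.source) {F : Type*} [NormedAddCommGroup F]
    [NormedSpace ℝ F] {g : E' → F} (hg : DifferentiableAt ℝ g (φ y)) (f : E' → E') :
    mvfderiv 𝓘(ℝ, E) (g ∘ φ) y (ofCoord φ f y) = fderiv ℝ g (φ y) (f (φ y)) := by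
  have h : mfderiv 𝓘(ℝ, E) 𝓘(ℝ, F) (g ∘ φ) y
      = (mfderiv 𝓘(ℝ, E') 𝓘(ℝ, F) g (φ y)).comp (mfderiv 𝓘(ℝ, E) 𝓘(ℝ, E') φ y) :=
    mfderiv_comp y hg.mdifferentiableAt (hφ.mdiffAt hy)
  have h2 := congrArg (fun L ↦ L (ofCoord φ f y)) h
  rw [mfderiv_eq_fderiv] at h2
  exact h2.trans (congrArg (fderiv ℝ g (φ y)) (hφ.mfderiv_ofCoord hy f))

end IsSmoothChart

end CoordinateFields

/-! ### Christoffel symbols. -/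

section Christoffel

variable {E : Type*} [NormedAddCommGroup E] [NormedSpace ℝ E] [FiniteDimensional ℝ E]
  {M : Type*} [TopologicalSpace M] [ChartedSpace E M] [IsManifold 𝓘(ℝ, E) ∞ M]
  {E' : Type*} [NormedAddCommGroup E'] [NormedSpace ℝ E'] [FiniteDimensional ℝ E']
  {cov : CovariantDerivative 𝓘(ℝ, E) E (TangentSpace 𝓘(ℝ, E) : M → Type _)}
  {φ : OpenPartialHomeomorph M E'} {y : M}

lemma CovariantDerivative.apply_sum {ι : Type*} (s : Finset ι)
    {σ : ι → Π x : M, TangentSpace 𝓘(ℝ, E) x} (hσ : ∀ i ∈ s, MDiffAt (T% (σ i)) y) :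
    cov (∑ i ∈ s, σ i) y = ∑ i ∈ s, cov (σ i) y := by
  classical
  induction s using Finset.induction_on with
  | empty => simp
  | insert i s hi ih =>
    rw [Finset.sum_insert hi, Finset.sum_insert hi, cov.isCovariantDerivativeOnUniv.add, ih]
    · exact fun j hj ↦ hσ j (Finset.mem_insert_of_mem hj)
    · exact hσ i (Finset.mem_insert_self _ _)
    · have := MDifferentiableAt.sum_section (s := s) (t := fun i x ↦ σ i x) (x₀ := y)
        fun j hj ↦ hσ j (Finset.mem_insert_of_mem hj)
      convert! this using 3
      simp

/-- The Christoffel symbols of a smooth connection in local coordinates. -/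
theorem IsSmoothChart.exists_christoffel (hφ : IsSmoothChart E φ)
    (hsm : ∀ {X Y : Π x : M, TangentSpace 𝓘(ℝ, E) x} {x : M}, CMDiffAt ∞ (T% X) x →
      CMDiffAt ∞ (T% Y) x → CMDiffAt ∞ (T% (fun y ↦ cov Y y (X y))) x) :
    ∃ Γ : E' → E' →L[ℝ] E' →L[ℝ] E', ContDiffOn ℝ ∞ Γ φ.target ∧
      ∀ y ∈ φ.source, ∀ (u : E') (f : E' → E'), DifferentiableAt ℝ f (φ y) →
        cov (ofCoord φ f) y (ofCoord φ (fun _ ↦ u) y)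
          = ofCoord φ (fun z ↦ fderiv ℝ f z u + Γ z u (f z)) y := by
  have hΓ : ∀ z ∈ φ.target, ∃ B : E' →L[ℝ] E' →L[ℝ] E', ∀ u v,
      cov (ofCoord φ (fun _ ↦ v)) (φ.symm z) (ofCoord φ (fun _ ↦ u) (φ.symm z))
        = ofCoord φ (fun _ ↦ B u v) (φ.symm z) := by
    intro z hz
    obtain ⟨y, hy, rfl⟩ : ∃ y ∈ φ.source, z = φ y :=
      ⟨φ.symm z, φ.map_target hz, (φ.right_inv hz).symm⟩
    rw [φ.left_inv hy]
    let D : TangentSpace 𝓘(ℝ, E) y →L[ℝ] E' := mfderiv 𝓘(ℝ, E) 𝓘(ℝ, E') φ y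
    let B : E' →ₗ[ℝ] E' →L[ℝ] E' :=
      { toFun v := (D.comp (cov (ofCoord φ (fun _ ↦ v)) y)).comp D.inverse
        map_add' v w := by
          have h : ofCoord (E := E) φ (fun _ ↦ v + w)
              = ofCoord φ (fun _ ↦ v) + ofCoord φ (fun _ ↦ w) := ofCoord_add φ _ _
          rw [h, cov.isCovariantDerivativeOnUniv.add (hφ.mdiffAt_ofCoord hy (by fun_prop))
            (hφ.mdiffAt_ofCoord hy (by fun_prop))]
          ext u
          simp
        map_smul' c v := by
          have h : ofCoord (E := E) φ (fun _ ↦ c • v) = c • ofCoord φ (fun _ ↦ v) :=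
            ofCoord_const_smul φ _ _
          rw [h, cov.isCovariantDerivativeOnUniv.smul_const _
            (hφ.mdiffAt_ofCoord hy (by fun_prop))]
          ext u
          simp }
    refine ⟨(LinearMap.toContinuousLinearMap B).flip, fun u v ↦ (hφ.eq_ofCoord_iff hy).2 ?_⟩
    rfl
  -- Off the target of φ the values of Γ are arbitrary.
  choose! Γ hΓ using hΓ
  have hΓ' : ∀ y ∈ φ.source, ∀ u v, cov (ofCoord φ (fun _ ↦ v)) y (ofCoord φ (fun _ ↦ u) y)
        = ofCoord φ (fun z ↦ Γ z u v) y := by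
    intro y hy u v
    have h := hΓ (φ y) (φ.map_source hy) u v
    rw [φ.left_inv hy] at h
    exact h
  refine ⟨Γ, ?_, fun y hy u f hf ↦ ?_⟩
  · rw [contDiffOn_clm_apply]
    intro u
    rw [contDiffOn_clm_apply]
    intro v z hz
    -- For fixed u and v, Γ z u v is the coordinate expression of the derivative of one constant
    -- field along another, hence smooth by `hsm`.
    obtain ⟨g, hg, hgs⟩ := hφ.exists_eq_ofCoord
      (fun y ↦ cov (ofCoord φ (fun _ ↦ v)) y (ofCoord φ (fun _ ↦ u) y))
    have hy := φ.map_target hz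
    have h1 := hgs (φ.symm z) hy (hsm (hφ.contMDiffAt_ofCoord hy contDiffAt_const)
      (hφ.contMDiffAt_ofCoord hy contDiffAt_const))
    rw [φ.right_inv hz] at h1
    refine (h1.congr_of_eventuallyEq ?_).contDiffWithinAt
    filter_upwards [φ.open_target.mem_nhds hz] with z' hz'
    have hy' := φ.map_target hz'
    have h2 := (hφ.ofCoord_inj hy').1 ((hΓ' _ hy' u v).symm.trans (hg _ hy'))
    rwa [φ.right_inv hz'] at h2
  -- The general f is a combination of constant fields b i with function coefficients; the Leibniz
  -- rule produces the derivative of f and the Γ term.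
  · let b := Module.finBasis ℝ E'
    have hfi : ∀ i, DifferentiableAt ℝ (fun z ↦ b.coord i (f z)) (φ y) := fun i ↦
      (LinearMap.toContinuousLinearMap (b.coord i)).differentiableAt.comp _ hf
    have hfd : ∀ i, fderiv ℝ (fun z ↦ b.coord i (f z)) (φ y) u
        = b.coord i (fderiv ℝ f (φ y) u) := fun i ↦ by
      have := ((LinearMap.toContinuousLinearMap (b.coord i)).hasFDerivAt.comp (φ y)
        hf.hasFDerivAt).fderiv
      exact congrArg (fun L ↦ L u) this
    have hsum : ofCoord (E := E) φ f
        = ∑ i, ((fun z ↦ b.coord i (f z)) ∘ φ) • ofCoord φ (fun _ ↦ b i) := by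
      simp only [← ofCoord_smul]
      rw [← ofCoord_sum]
      congr 1
      funext z
      exact (b.sum_repr (f z)).symm
    have hmd : ∀ i, MDiffAt (fun x ↦ ((fun z ↦ b.coord i (f z)) ∘ φ) x) y := fun i ↦
      (hfi i).mdifferentiableAt.comp y (hφ.mdiffAt hy)
    have hcb : ∀ i, MDiffAt (T% (ofCoord (E := E) φ (fun _ ↦ b i))) y := fun i ↦
      hφ.mdiffAt_ofCoord hy (by fun_prop)
    rw [hsum, CovariantDerivative.apply_sum _ fun i _ ↦ (hmd i).smul_section (hcb i)]
    have hterm : ∀ i, cov (((fun z ↦ b.coord i (f z)) ∘ φ) • ofCoord φ (fun _ ↦ b i)) y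
        (ofCoord φ (fun _ ↦ u) y) = ofCoord φ (fun z ↦ b.coord i (f z) • Γ z u (b i)
          + b.coord i (fderiv ℝ f z u) • b i) y := by
      intro i
      rw [cov.isCovariantDerivativeOnUniv.leibniz (hcb i) (hmd i)]
      have h1 := hΓ' y hy u (b i)
      have h2 := hφ.mvfderiv_comp_ofCoord hy (hfi i) (fun _ ↦ u)
      rw [hfd i] at h2
      rw [add_apply, smul_apply, ContinuousLinearMap.smulRight_apply, h1, h2]
      let L : E' →L[ℝ] TangentSpace 𝓘(ℝ, E) y := (mfderiv 𝓘(ℝ, E) 𝓘(ℝ, E') φ y).inverse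
      have hL : ∀ (c d : ℝ) (v w : E'), L (c • v + d • w) = c • L v + d • L w := by simp
      exact (hL _ _ _ _).symm
    rw [sum_apply]
    simp only [hterm]
    rw [← Finset.sum_apply, ← ofCoord_sum]
    refine ofCoord_congr ?_
    rw [Finset.sum_add_distrib, add_comm]
    congr 1
    · exact b.sum_repr _
    · conv_rhs => rw [← b.sum_repr (f (φ y)), map_sum]
      simp

end Christoffel

/-! ### Torsion and curvature in local coordinates. -/

section LocalComputations

variable {E : Type*} [NormedAddCommGroup E] [NormedSpace ℝ E] [FiniteDimensional ℝ E]
  {M : Type*} [TopologicalSpace M] [ChartedSpace E M] [IsManifold 𝓘(ℝ, E) ∞ M]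
  {E' : Type*} [NormedAddCommGroup E'] [NormedSpace ℝ E'] [FiniteDimensional ℝ E']
  {cov : CovariantDerivative 𝓘(ℝ, E) E (TangentSpace 𝓘(ℝ, E) : M → Type _)}
  {φ : OpenPartialHomeomorph M E'} {y : M}

lemma MDifferentiableAt.congr_section {X Y : Π x : M, TangentSpace 𝓘(ℝ, E) x}
    (hY : MDiffAt (T% Y) y) (h : X =ᶠ[𝓝 y] Y) : MDiffAt (T% X) y :=
  hY.congr_of_eventuallyEq (h.mono fun x hx ↦ by simp only [hx])

lemma ContMDiffAt.congr_section {X Y : Π x : M, TangentSpace 𝓘(ℝ, E) x}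
    (hY : CMDiffAt ∞ (T% Y) y) (h : X =ᶠ[𝓝 y] Y) : CMDiffAt ∞ (T% X) y :=
  hY.congr_of_eventuallyEq (h.mono fun x hx ↦ by simp only [hx])

/-- Smoothness of order ∞ at a point provides a neighbourhood for each finite order, not a common
one; order 1 suffices here. -/
lemma ContMDiffAt.eventually_mdiffAt_section {X : Π x : M, TangentSpace 𝓘(ℝ, E) x}
    (hX : CMDiffAt ∞ (T% X) y) : ∀ᶠ x in 𝓝 y, MDiffAt (T% X) x := by
  have h1 : CMDiffAt 1 (T% X) y := hX.of_le ENat.LEInfty.out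
  have h2 : IsManifold 𝓘(ℝ, E).tangent 1 (TangentBundle 𝓘(ℝ, E) M) := inferInstance
  filter_upwards [(contMDiffAt_iff_contMDiffAt_nhds (by simp)).1 h1] with x hx
  exact hx.mdifferentiableAt (by simp)

lemma CovariantDerivative.congr_of_eventuallyEq {X Y : Π x : M, TangentSpace 𝓘(ℝ, E) x}
    (hY : MDiffAt (T% Y) y) (h : X =ᶠ[𝓝 y] Y) : cov X y = cov Y y :=
  cov.isCovariantDerivativeOnUniv.congr_of_eventuallyEq (hY.congr_section h) hY
    Filter.univ_mem h

/-- A vector field which is smooth near a point agrees near this point with a global smooth one. -/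
lemma exists_contMDiff_eventuallyEq [T2Space M] {X : Π x : M, TangentSpace 𝓘(ℝ, E) x} {U : Set M}
    (hU : IsOpen U) (hy : y ∈ U) (hX : CMDiff[U] ∞ (T% X)) :
    ∃ Y : Π x : M, TangentSpace 𝓘(ℝ, E) x, CMDiff ∞ (T% Y) ∧ Y =ᶠ[𝓝 y] X := by
  obtain ⟨f, -, hf⟩ := (SmoothBumpFunction.nhds_basis_tsupport (I := 𝓘(ℝ, E)) y).mem_iff.1
    (hU.mem_nhds hy)
  refine ⟨(f : M → ℝ) • X, contMDiffOn_univ.1 ?_, ?_⟩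
  · exact (ContMDiffOn.smul_section_of_tsupport f.contMDiff.contMDiffOn hU hf hX).contMDiffOn
  · filter_upwards [f.eventuallyEq_one] with x hx
    change f x • X x = X x
    rw [hx]
    exact one_smul _ _

section Gamma

variable {Γ : E' → E' →L[ℝ] E' →L[ℝ] E'}
  (hΓ : ∀ y ∈ φ.source, ∀ (u : E') (f : E' → E'), DifferentiableAt ℝ f (φ y) →
    cov (ofCoord φ f) y (ofCoord φ (fun _ ↦ u) y)
      = ofCoord φ (fun z ↦ fderiv ℝ f z u + Γ z u (f z)) y)
include hΓ

/-- The direction of differentiation enters only through its value at y, so it may be frozen to a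
constant field. -/
lemma cov_ofCoord_apply (hy : y ∈ φ.source) {f : E' → E'} (g : E' → E')
    (hf : DifferentiableAt ℝ f (φ y)) : cov (ofCoord φ f) y (ofCoord φ g y)
      = ofCoord φ (fun z ↦ fderiv ℝ f z (g z) + Γ z (g z) (f z)) y := by
  rw [ofCoord_congr (g := fun _ ↦ g (φ y)) rfl, hΓ y hy _ f hf]
  exact ofCoord_congr rfl

/-- Fields given only near y are allowed because the curvature condition is tested on global fields.
Locality of the connection holds for differentiable fields only, hence `hh` on a neighbourhood and
`hkd` for the outer derivative. -/
lemma cov_cov_ofCoord (hφ : IsSmoothChart E φ) (hy : y ∈ φ.source) (f : E' → E')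
    {g h k : E' → E'} {Y Z : Π x : M, TangentSpace 𝓘(ℝ, E) x}
    (hY : Y =ᶠ[𝓝 y] ofCoord φ g) (hZ : Z =ᶠ[𝓝 y] ofCoord φ h)
    (hk : ∀ z, k z = fderiv ℝ h z (g z) + Γ z (g z) (h z))
    (hh : ∀ᶠ z in 𝓝 (φ y), DifferentiableAt ℝ h z) (hkd : DifferentiableAt ℝ k (φ y)) :
    cov (fun x ↦ cov Z x (Y x)) y (ofCoord φ f y)
      = ofCoord φ (fun z ↦ fderiv ℝ k z (f z) + Γ z (f z) (k z)) y := by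
  rw [← cov_ofCoord_apply hΓ hy f hkd]
  rw [cov.congr_of_eventuallyEq (hφ.mdiffAt_ofCoord hy hkd)]
  filter_upwards [hY, hZ.eventuallyEq_nhds, φ.open_source.mem_nhds hy,
    (φ.continuousAt hy).eventually hh] with x hx1 hx2 hx3 hx4
  rw [hx1, cov.congr_of_eventuallyEq (hφ.mdiffAt_ofCoord hx3 hx4) hx2,
    cov_ofCoord_apply hΓ hx3 g hx4]
  exact ofCoord_congr (hk _).symm

set_option synthInstance.maxHeartbeats 200000 in
/-- The curvature in terms of the Christoffel symbols. -/
lemma curvature_christoffel (hφ : IsSmoothChart E φ) (hΓs : ContDiffOn ℝ ∞ Γ φ.target)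
    (hy : y ∈ φ.source) (u v w : E') {X Y Z : Π x : M, TangentSpace 𝓘(ℝ, E) x}
    (hX : X =ᶠ[𝓝 y] ofCoord φ (fun _ ↦ u)) (hY : Y =ᶠ[𝓝 y] ofCoord φ (fun _ ↦ v))
    (hZ : Z =ᶠ[𝓝 y] ofCoord φ (fun _ ↦ w)) :
    curvatureField cov X Y Z y = ofCoord φ (fun z ↦ (fderiv ℝ Γ z u v - fderiv ℝ Γ z v u
      + (Γ z u).comp (Γ z v) - (Γ z v).comp (Γ z u)) w) y := by
  have hΓd : DifferentiableAt ℝ Γ (φ y) := ((hΓs.contDiffAt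
    (φ.open_target.mem_nhds (φ.map_source hy))).differentiableAt (by simp))
  have hk : ∀ v, DifferentiableAt ℝ (fun z ↦ Γ z v w) (φ y) := fun v ↦ by fun_prop
  have hkd : ∀ u v, fderiv ℝ (fun z ↦ Γ z v w) (φ y) u = fderiv ℝ Γ (φ y) u v w := fun u v ↦ by
    rw [((hΓd.hasFDerivAt.clm_apply (hasFDerivAt_const v _)).clm_apply
      (hasFDerivAt_const w _)).fderiv]
    simp
  have hb : mlieBracket 𝓘(ℝ, E) X Y y = 0 := by
    rw [hX.mlieBracket_vectorField_eq hY, hφ.mlieBracket_ofCoord hy (by fun_prop) (by fun_prop)]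
    rw [ofCoord_congr (g := 0) (by simp), ofCoord_zero]
    rfl
  rw [curvatureField, hb, map_zero, hX.self_of_nhds, hY.self_of_nhds,
    cov_cov_ofCoord hΓ hφ hy (fun _ ↦ u) (k := fun z ↦ Γ z v w) hY hZ (by simp) (by simp) (hk v),
    cov_cov_ofCoord hΓ hφ hy (fun _ ↦ v) (k := fun z ↦ Γ z u w) hX hZ (by simp) (by simp) (hk u),
    ← ofCoord_sub, sub_zero]
  refine ofCoord_congr ?_
  simp only [Pi.sub_apply, hkd, add_apply, sub_apply, ContinuousLinearMap.comp_apply]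
  abel

lemma torsion_christoffel (hφ : IsSmoothChart E φ) (hy : y ∈ φ.source) (u v : E') :
    cov.torsion y (ofCoord φ (fun _ ↦ u) y) (ofCoord φ (fun _ ↦ v) y)
      = ofCoord φ (fun z ↦ Γ z u v - Γ z v u) y := by
  rw [cov.torsion_apply (hφ.mdiffAt_ofCoord hy (by fun_prop))
    (hφ.mdiffAt_ofCoord hy (by fun_prop)), hΓ y hy _ _ (by fun_prop), hΓ y hy _ _ (by fun_prop),
    hφ.mlieBracket_ofCoord hy (by fun_prop) (by fun_prop), ← ofCoord_sub, ← ofCoord_sub]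
  exact ofCoord_congr (by simp)

end Gamma

/-- A connection with vanishing Christoffel symbols has no curvature. -/
lemma curvatureField_eq_zero_of_christoffel_eq_zero (hφ : IsSmoothChart E φ)
    (h0 : ∀ y ∈ φ.source, ∀ (u : E') (f : E' → E'), DifferentiableAt ℝ f (φ y) →
      cov (ofCoord φ f) y (ofCoord φ (fun _ ↦ u) y) = ofCoord φ (fun z ↦ fderiv ℝ f z u) y)
    (hy : y ∈ φ.source) {X Y Z : Π x : M, TangentSpace 𝓘(ℝ, E) x} (hX : CMDiffAt ∞ (T% X) y)
    (hY : CMDiffAt ∞ (T% Y) y) (hZ : CMDiffAt ∞ (T% Z) y) : curvatureField cov X Y Z y = 0 := by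
  have hΓ : ∀ y ∈ φ.source, ∀ (u : E') (f : E' → E'), DifferentiableAt ℝ f (φ y) →
    cov (ofCoord φ f) y (ofCoord φ (fun _ ↦ u) y)
      = ofCoord φ (fun z ↦ fderiv ℝ f z u + (0 : E' → E' →L[ℝ] E' →L[ℝ] E') z u (f z)) y := by
    simpa using h0
  have hs := φ.open_source.mem_nhds hy
  obtain ⟨f, hf, hfs⟩ := hφ.exists_eq_ofCoord X
  obtain ⟨g, hg, hgs⟩ := hφ.exists_eq_ofCoord Y
  obtain ⟨h, hh, hhs⟩ := hφ.exists_eq_ofCoord Z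
  have hX' : X =ᶠ[𝓝 y] ofCoord φ f := Filter.eventually_of_mem hs hf
  have hY' : Y =ᶠ[𝓝 y] ofCoord φ g := Filter.eventually_of_mem hs hg
  have hZ' : Z =ᶠ[𝓝 y] ofCoord φ h := Filter.eventually_of_mem hs hh
  have hfd := (hfs y hy hX).differentiableAt (by simp)
  have hgd := (hgs y hy hY).differentiableAt (by simp)
  have hh2 : ContDiffAt ℝ 2 h (φ y) := (hhs y hy hZ).of_le ENat.LEInfty.out
  have hhd : ∀ᶠ z in 𝓝 (φ y), DifferentiableAt ℝ h z := by
    filter_upwards [hh2.eventually (by simp)] with z hz using hz.differentiableAt (by simp)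
  have hDh : DifferentiableAt ℝ (fderiv ℝ h) (φ y) :=
    (hh2.fderiv_right (m := 1) (by norm_num)).differentiableAt (by simp)
  have hk : ∀ {g : E' → E'}, DifferentiableAt ℝ g (φ y) → ∀ v,
      fderiv ℝ (fun z ↦ fderiv ℝ h z (g z)) (φ y) v
        = fderiv ℝ (fderiv ℝ h) (φ y) v (g (φ y)) + fderiv ℝ h (φ y) (fderiv ℝ g (φ y) v) := by
    intro g hg v
    rw [(hDh.hasFDerivAt.clm_apply hg.hasFDerivAt).fderiv]
    simp [add_comm]
  rw [curvatureField, hX'.mlieBracket_vectorField_eq hY', hφ.mlieBracket_ofCoord hy hfd hgd,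
    hX'.self_of_nhds, hY'.self_of_nhds,
    cov.congr_of_eventuallyEq (hφ.mdiffAt_ofCoord hy hhd.self_of_nhds) hZ',
    cov_ofCoord_apply hΓ hy _ hhd.self_of_nhds,
    cov_cov_ofCoord hΓ hφ hy f (k := fun z ↦ fderiv ℝ h z (g z)) hY' hZ' (by simp) hhd
      (hDh.clm_apply hgd),
    cov_cov_ofCoord hΓ hφ hy g (k := fun z ↦ fderiv ℝ h z (f z)) hX' hZ' (by simp) hhd
      (hDh.clm_apply hfd), ← ofCoord_sub, ← ofCoord_sub]
  rw [ofCoord_congr (g := 0), ofCoord_zero]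
  · rfl
  -- The second derivatives of h cancel by symmetry; the remaining terms Dh(Dg f - Df g) are those
  -- of the bracket.
  · have hsymm : IsSymmSndFDerivAt ℝ h (φ y) := hh2.isSymmSndFDerivAt (by simp)
    simp only [Pi.sub_apply, Pi.zero_apply, zero_apply, add_zero, hk hgd, hk hfd, map_sub,
      hsymm.eq (f (φ y)) (g (φ y))]
    rw [sub_zero, show (0 : E' →L[ℝ] E') (h (φ y)) = 0 from rfl]
    abel

end LocalComputations

/-! ### Charts in which parallel fields of endomorphisms are constant. -/

section ParallelCharts

variable {E : Type*} [NormedAddCommGroup E] [NormedSpace ℝ E]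
  {M : Type*} [TopologicalSpace M] [ChartedSpace E M]
  {E' : Type*} [NormedAddCommGroup E'] [NormedSpace ℝ E']
  {E'' : Type*} [NormedAddCommGroup E''] [NormedSpace ℝ E'']
  {φ : OpenPartialHomeomorph M E'} {y : M}

namespace IsSmoothChart

lemma trans (hφ : IsSmoothChart E φ) {Φ : OpenPartialHomeomorph E' E''}
    (hΦ : ContDiffOn ℝ ∞ Φ Φ.source) (hΦ' : ContDiffOn ℝ ∞ Φ.symm Φ.target) :
    IsSmoothChart E (φ.trans Φ) where
  contMDiffOn := by
    refine hΦ.contMDiffOn.comp (hφ.contMDiffOn.mono ?_) ?_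
    · exact fun y hy ↦ by rw [φ.trans_source] at hy; exact hy.1
    · exact fun y hy ↦ by rw [φ.trans_source] at hy; exact hy.2
  contMDiffOn_symm := by
    refine hφ.contMDiffOn_symm.comp (hΦ'.contMDiffOn.mono ?_) ?_
    · exact fun y hy ↦ by rw [φ.trans_target] at hy; exact hy.1
    · exact fun y hy ↦ by rw [φ.trans_target] at hy; exact hy.2

lemma mfderiv_trans (hφ : IsSmoothChart E φ) {Φ : OpenPartialHomeomorph E' E''}
    (hΦ : ContDiffOn ℝ ∞ Φ Φ.source) (hy : y ∈ (φ.trans Φ).source) (v : TangentSpace 𝓘(ℝ, E) y) :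
    mfderiv 𝓘(ℝ, E) 𝓘(ℝ, E'') (φ.trans Φ) y v
      = fderiv ℝ Φ (φ y) (mfderiv 𝓘(ℝ, E) 𝓘(ℝ, E') φ y v) := by
  rw [φ.trans_source] at hy
  have hd : DifferentiableAt ℝ Φ (φ y) :=
    (hΦ.contDiffAt (Φ.open_source.mem_nhds hy.2)).differentiableAt (by simp)
  have h : mfderiv 𝓘(ℝ, E) 𝓘(ℝ, E'') (φ.trans Φ) y
      = (mfderiv 𝓘(ℝ, E') 𝓘(ℝ, E'') Φ (φ y)).comp (mfderiv 𝓘(ℝ, E) 𝓘(ℝ, E') φ y) :=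
    mfderiv_comp y hd.mdifferentiableAt (hφ.mdiffAt hy.1)
  rw [mfderiv_eq_fderiv] at h
  exact congrArg (fun L ↦ L v) h

lemma chartAt [IsManifold 𝓘(ℝ, E) ∞ M] (x : M) : IsSmoothChart E (chartAt E x) where
  contMDiffOn := contMDiffOn_chart
  contMDiffOn_symm := contMDiffOn_chart_symm

lemma trans_continuousLinearEquiv (hφ : IsSmoothChart E φ) (L : E' ≃L[ℝ] E'') :
    IsSmoothChart E (φ.trans L.toHomeomorph.toOpenPartialHomeomorph) :=
  hφ.trans L.contDiff.contDiffOn L.symm.contDiff.contDiffOn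

variable [FiniteDimensional ℝ E] [IsManifold 𝓘(ℝ, E) ∞ M]

lemma ofCoord_trans_continuousLinearEquiv (hφ : IsSmoothChart E φ) (L : E' ≃L[ℝ] E'')
    (hy : y ∈ φ.source) (w : E'') :
    ofCoord (E := E) (φ.trans L.toHomeomorph.toOpenPartialHomeomorph) (fun _ ↦ w) y
      = ofCoord φ (fun _ ↦ L.symm w) y := by
  have hy' : y ∈ (φ.trans L.toHomeomorph.toOpenPartialHomeomorph).source := by simpa using hy
  refine (((hφ.trans_continuousLinearEquiv L).eq_ofCoord_iff hy').2 ?_).symm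
  rw [hφ.mfderiv_trans L.contDiff.contDiffOn hy', hφ.mfderiv_ofCoord hy]
  have : fderiv ℝ L.toHomeomorph.toOpenPartialHomeomorph (φ y) = L := L.fderiv
  rw [this]
  exact L.apply_symm_apply w

end IsSmoothChart

variable [FiniteDimensional ℝ E] [IsManifold 𝓘(ℝ, E) ∞ M]

/-- By uniqueness the canonical connection agrees on differentiable fields with the explicit formula
in Lie brackets, whose smoothness is local; this covers fields that are smooth only at the point
considered. -/
lemma AlmostBiparacomplex.contMDiffAt_canonicalConnection (S : AlmostBiparacomplex E M)
    {X Y : Π x : M, TangentSpace 𝓘(ℝ, E) x} (hX : CMDiffAt ∞ (T% X) y)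
    (hY : CMDiffAt ∞ (T% Y) y) :
    CMDiffAt ∞ (T% (fun x ↦ S.canonicalConnection Y x (X x))) y := by
  refine (S.contMDiffAt_canonicalDeriv hX hY).congr_section ?_
  filter_upwards [hX.eventually_mdiffAt_section, hY.eventually_mdiffAt_section] with x h1 h2
  rw [S.isCanonicalConnection_canonicalConnection.eq S.isCanonicalConnection_explicitConnection h2,
    S.explicitConnection_apply h1]

/-- The coordinate expression of a field of endomorphisms. -/
lemma IsSmoothChart.exists_endomorphism_coord [FiniteDimensional ℝ E'] (hφ : IsSmoothChart E φ)
    {A : Π x : M, TangentSpace 𝓘(ℝ, E) x →L[ℝ] TangentSpace 𝓘(ℝ, E) x}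
    (hA : ∀ {X : Π x : M, TangentSpace 𝓘(ℝ, E) x} {x : M}, CMDiffAt ∞ (T% X) x →
      CMDiffAt ∞ (T% (fun y ↦ A y (X y))) x) :
    ∃ K : E' → E' →L[ℝ] E', ContDiffOn ℝ ∞ K φ.target ∧
      ∀ y ∈ φ.source, ∀ f : E' → E', A y (ofCoord φ f y) = ofCoord φ (fun z ↦ K z (f z)) y := by
  have hK : ∀ z ∈ φ.target, ∃ B : E' →L[ℝ] E', ∀ v,
      A (φ.symm z) (ofCoord φ (fun _ ↦ v) (φ.symm z)) = ofCoord φ (fun _ ↦ B v) (φ.symm z) := by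
    intro z hz
    have hy := φ.map_target hz
    let D : TangentSpace 𝓘(ℝ, E) (φ.symm z) →L[ℝ] E' := mfderiv 𝓘(ℝ, E) 𝓘(ℝ, E') φ (φ.symm z)
    exact ⟨(D.comp (A _)).comp D.inverse, fun v ↦ (hφ.eq_ofCoord_iff hy).2 rfl⟩
  choose! K hK using hK
  have hK' : ∀ y ∈ φ.source, ∀ f : E' → E',
      A y (ofCoord φ f y) = ofCoord φ (fun z ↦ K z (f z)) y := by
    intro y hy f
    have h := hK (φ y) (φ.map_source hy) (f (φ y))
    rw [φ.left_inv hy] at h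
    exact h
  refine ⟨K, ?_, hK'⟩
  rw [contDiffOn_clm_apply]
  intro v z hz
  obtain ⟨g, hg, hgs⟩ := hφ.exists_eq_ofCoord (fun y ↦ A y (ofCoord φ (fun _ ↦ v) y))
  have hy := φ.map_target hz
  have h1 := hgs (φ.symm z) hy (hA (hφ.contMDiffAt_ofCoord hy contDiffAt_const))
  rw [φ.right_inv hz] at h1
  refine (h1.congr_of_eventuallyEq ?_).contDiffWithinAt
  filter_upwards [φ.open_target.mem_nhds hz] with z' hz'
  have hy' := φ.map_target hz'
  have h2 := (hφ.ofCoord_inj hy').1 ((hK' _ hy' fun _ ↦ v).symm.trans (hg _ hy'))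
  rwa [φ.right_inv hz'] at h2

/-- A flat torsion-free connection admits charts in which all parallel fields of endomorphisms are
constant. -/
theorem exists_chart_forall_isParallel [T2Space M]
    {cov : CovariantDerivative 𝓘(ℝ, E) E (TangentSpace 𝓘(ℝ, E) : M → Type _)}
    (hsm : ∀ {X Y : Π x : M, TangentSpace 𝓘(ℝ, E) x} {x : M}, CMDiffAt ∞ (T% X) x →
      CMDiffAt ∞ (T% Y) x → CMDiffAt ∞ (T% (fun y ↦ cov Y y (X y))) x)
    (hT : cov.torsion = 0) (hR : IsCurvatureFree cov) (x : M) :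
    ∃ ψ : OpenPartialHomeomorph M E, x ∈ ψ.source ∧ IsSmoothChart E ψ ∧
      ∀ A : Π x : M, TangentSpace 𝓘(ℝ, E) x →L[ℝ] TangentSpace 𝓘(ℝ, E) x,
        (∀ {X : Π x : M, TangentSpace 𝓘(ℝ, E) x} {x : M}, CMDiffAt ∞ (T% X) x →
          CMDiffAt ∞ (T% (fun y ↦ A y (X y))) x) → IsParallel cov A →
        ∃ C : E →L[ℝ] E, ∀ y ∈ ψ.source, ∀ v : TangentSpace 𝓘(ℝ, E) y,
          mfderiv 𝓘(ℝ, E) 𝓘(ℝ, E) ψ y (A y v) = C (mfderiv 𝓘(ℝ, E) 𝓘(ℝ, E) ψ y v) := by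
  have hφ : IsSmoothChart E (chartAt E x) := .chartAt x
  have hx : x ∈ (chartAt E x).source := mem_chart_source E x
  generalize chartAt E x = φ at hφ hx
  obtain ⟨Γ, hΓs, hΓ⟩ := hφ.exists_christoffel hsm
  have hcs : ∀ u : E, CMDiff[φ.source] ∞ (T% (ofCoord (E := E) φ fun _ ↦ u)) := fun u y hy ↦
    (hφ.contMDiffAt_ofCoord hy contDiffAt_const).contMDiffWithinAt
  have hsymm : ∀ z ∈ φ.target, ∀ u v, Γ z u v = Γ z v u := by
    intro z hz u v
    have hy := φ.map_target hz
    have h1 := torsion_christoffel hΓ hφ hy u v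
    rw [hT] at h1
    have h2 := (hφ.ofCoord_inj hy).1 ((congrFun (ofCoord_zero φ) _).trans h1)
    rw [φ.right_inv hz] at h2
    exact sub_eq_zero.1 h2.symm
  have hflat : ∀ z ∈ φ.target, ∀ u v,
      fderiv ℝ Γ z u v - fderiv ℝ Γ z v u + Γ z u * Γ z v - Γ z v * Γ z u = 0 := by
    intro z hz u v
    have hy := φ.map_target hz
    ext w
    -- `hR` speaks of globally smooth fields, so the constant coordinate fields are replaced by
    -- global ones with the same germ at the point.
    obtain ⟨X, hX, hX'⟩ := exists_contMDiff_eventuallyEq φ.open_source hy (hcs u)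
    obtain ⟨Y, hY, hY'⟩ := exists_contMDiff_eventuallyEq φ.open_source hy (hcs v)
    obtain ⟨Z, hZ, hZ'⟩ := exists_contMDiff_eventuallyEq φ.open_source hy (hcs w)
    have h1 := curvature_christoffel hΓ hφ hΓs hy u v w hX' hY' hZ'
    rw [hR X Y Z hX hY hZ] at h1
    have h2 := (hφ.ofCoord_inj hy).1 ((congrFun (ofCoord_zero φ) _).trans h1)
    rw [φ.right_inv hz] at h2
    exact h2.symm
  obtain ⟨Φ, hΦx, hΦU, hΦs, hΦs', -, hΦ⟩ :=
    exists_flat_coordinates φ.open_target (φ.map_source hx) hΓs hsymm hflat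
  refine ⟨φ.trans Φ, ?_, hφ.trans hΦs hΦs', fun A hA hAp ↦ ?_⟩
  · rw [φ.trans_source]
    exact ⟨hx, hΦx⟩
  obtain ⟨K, hKs, hK⟩ := hφ.exists_endomorphism_coord hA
  have hKd : ∀ z ∈ φ.target, DifferentiableAt ℝ K z := fun z hz ↦
    (hKs.contDiffAt (φ.open_target.mem_nhds hz)).differentiableAt (by simp)
  -- Parallelism of A, tested on constant fields v in constant directions u.
  have hKp : ∀ z ∈ φ.target, ∀ u, fderiv ℝ K z u + Γ z u * K z = K z * Γ z u := by
    intro z hz u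
    have hy := φ.map_target hz
    have hKz := hKd z hz
    ext v
    have h1 := hAp (ofCoord φ fun _ ↦ v) (φ.symm z) (hφ.mdiffAt_ofCoord hy (by fun_prop))
      (ofCoord φ (fun _ ↦ u) (φ.symm z))
    have hKz' : DifferentiableAt ℝ (fun z ↦ K z v) (φ (φ.symm z)) := by
      rw [φ.right_inv hz]
      fun_prop
    rw [cov.congr_of_eventuallyEq (hφ.mdiffAt_ofCoord hy hKz')
      (Filter.eventually_of_mem (φ.open_source.mem_nhds hy) fun y hy ↦ hK y hy fun _ ↦ v),
      hΓ _ hy _ _ hKz', hΓ _ hy _ _ (by fun_prop), hK _ hy] at h1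
    have h2 := (hφ.ofCoord_inj hy).1 h1
    rw [φ.right_inv hz] at h2
    have h3 : fderiv ℝ (fun z ↦ K z v) z u = fderiv ℝ K z u v := by
      rw [(hKz.hasFDerivAt.clm_apply (hasFDerivAt_const v _)).fderiv]
      simp
    rw [h3] at h2
    simpa using h2
  have hC := hΦ K hKd hKp
  refine ⟨K (φ x), fun y hy v ↦ ?_⟩
  rw [hφ.mfderiv_trans hΦs hy, hφ.mfderiv_trans hΦs hy]
  rw [φ.trans_source] at hy
  obtain ⟨w, hw⟩ : ∃ w : E, mfderiv 𝓘(ℝ, E) 𝓘(ℝ, E) φ y v = w := ⟨_, rfl⟩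
  have h1 : v = ofCoord φ (fun _ ↦ w) y := (hφ.eq_ofCoord_iff hy.1).2 hw
  have h2 : mfderiv 𝓘(ℝ, E) 𝓘(ℝ, E) φ y (A y v) = K (φ y) w :=
    (congrArg (mfderiv 𝓘(ℝ, E) 𝓘(ℝ, E) φ y)
      ((congrArg (A y) h1).trans (hK y hy.1 fun _ ↦ w))).trans (hφ.mfderiv_ofCoord hy.1 _)
  rw [h2, hw]
  exact congrArg (fun L ↦ L w) (hC _ hy.2)

end ParallelCharts

/-! ### The implications between flatness, integrability and standard coordinates. -/

section Integrability

variable {E : Type*} [NormedAddCommGroup E] [NormedSpace ℝ E] [FiniteDimensional ℝ E]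
  {M : Type*} [TopologicalSpace M] [ChartedSpace E M] [IsManifold 𝓘(ℝ, E) ∞ M]
  {E' : Type*} [NormedAddCommGroup E'] [NormedSpace ℝ E']
  {n : ℕ} {S : AlmostBiparacomplex E M}

lemma IsSmoothCoordinates.isSmoothChart {ι : Type*} [Fintype ι]
    {φ : OpenPartialHomeomorph M (EuclideanSpace ℝ ι)} (hφ : IsSmoothCoordinates (E := E) φ) :
    IsSmoothChart E φ := ⟨hφ.contMDiffOn, hφ.contMDiffOn_symm⟩

lemma IsSmoothChart.isSmoothCoordinates {ι : Type*} [Fintype ι]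
    {φ : OpenPartialHomeomorph M (EuclideanSpace ℝ ι)} (hφ : IsSmoothChart E φ) :
    IsSmoothCoordinates (E := E) φ := ⟨hφ.contMDiffOn, hφ.contMDiffOn_symm⟩

lemma coordField_eq_ofCoord {ι : Type*} [Fintype ι] [DecidableEq ι]
    (φ : OpenPartialHomeomorph M (EuclideanSpace ℝ ι)) (i : ι) :
    coordField (E := E) φ i = ofCoord φ (fun _ ↦ EuclideanSpace.single i (1 : ℝ)) := rfl

namespace AlmostBiparacomplex

/-- If the canonical connection is flat and torsion free, then the `ΔGL(n, ℝ)`-structure is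
integrable. -/
theorem isIntegrable_of_flat [T2Space M] (hn : Module.finrank ℝ E = 2 * n)
    (hT : S.canonicalConnection.torsion = 0) (hR : IsCurvatureFree S.canonicalConnection) :
    (S.gStructure n hn).IsIntegrable := by
  intro x
  obtain ⟨ψ, hx, hψ, hC⟩ := exists_chart_forall_isParallel
    (fun hX hY ↦ S.contMDiffAt_canonicalConnection hX hY) hT hR x
  have hcan := S.isCanonicalConnection_canonicalConnection
  obtain ⟨CF, hCF⟩ := hC S.F (fun hX ↦ (S.contMDiff_F _).clm_bundle_apply hX) hcan.parallel_F
  obtain ⟨CP, hCP⟩ := hC S.P (fun hX ↦ (S.contMDiff_P _).clm_bundle_apply hX) hcan.parallel_P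
  obtain ⟨u, hu⟩ := S.exists_adapted_frame hn x
  -- An adapted frame at x, read in the chart. The constant endomorphisms CF and CP act on it as F
  -- and P do at x, and the same relations then hold at every other point of the chart.
  let b : Module.Basis (Fin n ⊕ Fin n) ℝ E :=
    u.map (hψ.mdifferentiable.mfderiv hx).toLinearEquiv
  have hb : ∀ i, b i = mfderiv 𝓘(ℝ, E) 𝓘(ℝ, E) ψ x (u i) := fun i ↦ u.map_apply _ i
  have hbF : ∀ i, CF (b (.inl i)) = b (.inl i) := fun i ↦ by
    rw [hb]
    refine (hCF x hx _).symm.trans ?_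
    rw [(hu i).1]
  have hbP : ∀ i, CP (b (.inl i)) = b (.inr i) := fun i ↦ by
    rw [hb, hb]
    refine (hCP x hx _).symm.trans ?_
    rw [← (hu i).2]
  -- Composing ψ with L makes the constant fields b i the coordinate fields.
  let L : E ≃L[ℝ] EuclideanSpace ℝ (Fin n ⊕ Fin n) :=
    b.equivFun.toContinuousLinearEquiv.trans (EuclideanSpace.equiv _ ℝ).symm
  have hL : ∀ i, L.symm (EuclideanSpace.single i 1) = b i := fun i ↦ by
    rw [ContinuousLinearEquiv.symm_apply_eq]
    ext j
    simp [L, Finsupp.single_apply, eq_comm]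
  have hA : ∀ {A : Π x : M, TangentSpace 𝓘(ℝ, E) x →L[ℝ] TangentSpace 𝓘(ℝ, E) x} {C : E →L[ℝ] E},
      (∀ y ∈ ψ.source, ∀ v : TangentSpace 𝓘(ℝ, E) y,
        mfderiv 𝓘(ℝ, E) 𝓘(ℝ, E) ψ y (A y v) = C (mfderiv 𝓘(ℝ, E) 𝓘(ℝ, E) ψ y v)) →
      ∀ y ∈ ψ.source, ∀ w, A y (ofCoord ψ (fun _ ↦ w) y) = ofCoord ψ (fun _ ↦ C w) y := by
    intro A C h y hy w
    refine (hψ.eq_ofCoord_iff hy).2 ((h y hy _).trans ?_)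
    exact congrArg C (hψ.mfderiv_ofCoord hy _)
  refine ⟨_, ?_, (hψ.trans_continuousLinearEquiv L).isSmoothCoordinates, fun y hy ↦ ?_⟩
  · simpa using hx
  have hy' : y ∈ ψ.source := by simpa using hy
  let v : Module.Basis (Fin n ⊕ Fin n) ℝ (TangentSpace 𝓘(ℝ, E) y) :=
    b.map (hψ.mdifferentiable.mfderiv hy').symm.toLinearEquiv
  have hv : ∀ i, v i = ofCoord ψ (fun _ ↦ b i) y := fun i ↦
    (hψ.eq_ofCoord_iff hy').2 ((hψ.mdifferentiable.mfderiv hy').apply_symm_apply (b i))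
  refine ⟨v, fun i ↦ ⟨?_, ?_⟩, fun i ↦ ?_⟩
  · rw [hv, hA hCF y hy', hbF]
  · rw [hv, hv, hA hCP y hy', hbP]
  · rw [hv, coordField_eq_ofCoord, hψ.ofCoord_trans_continuousLinearEquiv L hy', hL]

/-- The linear change of coordinates `(x, y) = (u + v, u - v)`. -/
def sumDiffEquiv (n : ℕ) :
    EuclideanSpace ℝ (Fin n ⊕ Fin n) ≃L[ℝ] EuclideanSpace ℝ (Fin n ⊕ Fin n) :=
  LinearEquiv.toContinuousLinearEquiv
    { toFun v := WithLp.toLp 2 (Sum.elim (fun i ↦ v (.inl i) + v (.inr i))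
        fun i ↦ v (.inl i) - v (.inr i))
      map_add' v w := by
        ext (i | i) <;> simp <;> ring
      map_smul' c v := by
        ext (i | i) <;> simp <;> ring
      invFun v := WithLp.toLp 2 (Sum.elim (fun i ↦ 2⁻¹ * (v (.inl i) + v (.inr i)))
        fun i ↦ 2⁻¹ * (v (.inl i) - v (.inr i)))
      left_inv v := by
        ext (i | i) <;> simp <;> ring
      right_inv v := by
        ext (i | i) <;> simp <;> ring }

lemma sumDiffEquiv_symm_single_inl (i : Fin n) :
    (sumDiffEquiv n).symm (EuclideanSpace.single (.inl i) 1)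
      = (2⁻¹ : ℝ) • (EuclideanSpace.single (.inl i) 1 + EuclideanSpace.single (.inr i) 1) := by
  rw [ContinuousLinearEquiv.symm_apply_eq]
  ext (j | j) <;> (simp [sumDiffEquiv] <;> split_ifs <;> norm_num)

lemma sumDiffEquiv_symm_single_inr (i : Fin n) :
    (sumDiffEquiv n).symm (EuclideanSpace.single (.inr i) 1)
      = (2⁻¹ : ℝ) • (EuclideanSpace.single (.inl i) 1 - EuclideanSpace.single (.inr i) 1) := by
  rw [ContinuousLinearEquiv.symm_apply_eq]
  ext (j | j) <;> (simp [sumDiffEquiv] <;> split_ifs <;> norm_num)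

/-- An adapted coordinate frame diagonalizes F and is exchanged by P; passing to half sums and half
differences reverses the two roles, and `sumDiffEquiv` realizes this passage on coordinates. -/
theorem hasStandardCoordinates_of_isIntegrable {hn : Module.finrank ℝ E = 2 * n}
    (h : (S.gStructure n hn).IsIntegrable) : S.HasStandardCoordinates n := by
  intro x
  obtain ⟨φ, hx, hφ, hf⟩ := h x
  have hφ' := hφ.isSmoothChart
  refine ⟨_, ?_, (hφ'.trans_continuousLinearEquiv (sumDiffEquiv n)).isSmoothCoordinates,
    fun y hy i ↦ ?_⟩
  · simpa using hx
  have hy' : y ∈ φ.source := by simpa using hy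
  obtain ⟨u, hu, hu'⟩ := hf y hy'
  obtain ⟨hF, hP⟩ := hu i
  rw [hu'] at hF
  rw [hu', hu'] at hP
  have h1 : coordField (E := E) (φ.trans (sumDiffEquiv n).toHomeomorph.toOpenPartialHomeomorph)
      (.inl i) y = (2⁻¹ : ℝ) • (coordField φ (.inl i) y + coordField φ (.inr i) y) := by
    rw [coordField_eq_ofCoord, hφ'.ofCoord_trans_continuousLinearEquiv _ hy',
      sumDiffEquiv_symm_single_inl]
    simp only [coordField_eq_ofCoord, ofCoord_apply]
    exact (map_smul _ _ _).trans (congrArg _ (map_add _ _ _))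
  have h2 : coordField (E := E) (φ.trans (sumDiffEquiv n).toHomeomorph.toOpenPartialHomeomorph)
      (.inr i) y = (2⁻¹ : ℝ) • (coordField φ (.inl i) y - coordField φ (.inr i) y) := by
    rw [coordField_eq_ofCoord, hφ'.ofCoord_trans_continuousLinearEquiv _ hy',
      sumDiffEquiv_symm_single_inr]
    simp only [coordField_eq_ofCoord, ofCoord_apply]
    exact (map_smul _ _ _).trans (congrArg _ (map_sub _ _ _))
  have hF' : S.F y (coordField φ (.inr i) y) = - coordField φ (.inr i) y := by
    rw [hP, F_P_eq, hF]
  have hP' : S.P y (coordField φ (.inr i) y) = coordField φ (.inl i) y := by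
    rw [hP, S.P_P]
  rw [h1, h2]
  simp only [map_smul, map_add, map_sub, hF, hF', hP', ← hP]
  refine ⟨?_, ?_, ?_, ?_⟩ <;> module

/-- If a field of endomorphisms maps coordinate vector fields to constant fields, then it maps
all constant fields to constant fields. -/
lemma exists_map_ofCoord_const {ι : Type*} [Fintype ι] [DecidableEq ι]
    {φ : OpenPartialHomeomorph M (EuclideanSpace ℝ ι)}
    {A : Π x : M, TangentSpace 𝓘(ℝ, E) x →L[ℝ] TangentSpace 𝓘(ℝ, E) x}
    (c : ι → EuclideanSpace ℝ ι)
    (hA : ∀ y ∈ φ.source, ∀ i, A y (coordField φ i y) = ofCoord φ (fun _ ↦ c i) y)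
    (w : EuclideanSpace ℝ ι) :
    ∃ w' : EuclideanSpace ℝ ι, ∀ y ∈ φ.source,
      A y (ofCoord φ (fun _ ↦ w) y) = ofCoord φ (fun _ ↦ w') y := by
  let b := (EuclideanSpace.basisFun ι ℝ).toBasis
  -- The linear map with values c i on the standard basis does not depend on y.
  refine ⟨b.constr ℝ c w, fun y hy ↦ ?_⟩
  let D : EuclideanSpace ℝ ι →L[ℝ] TangentSpace 𝓘(ℝ, E) y :=
    (mfderiv 𝓘(ℝ, E) 𝓘(ℝ, EuclideanSpace ℝ ι) φ y).inverse
  have h : (A y).toLinearMap ∘ₗ D.toLinearMap = D.toLinearMap ∘ₗ b.constr ℝ c := by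
    refine b.ext fun i ↦ ?_
    simp only [LinearMap.comp_apply, Module.Basis.constr_basis]
    have hb : b i = EuclideanSpace.single i 1 := by simp [b]
    rw [hb]
    exact hA y hy i
  exact congrArg (fun L ↦ L w) h

section Constant

variable [FiniteDimensional ℝ E'] {φ : OpenPartialHomeomorph M E'}

/-- The canonical connection annihilates constant fields if `F` and `P` preserve them. -/
lemma canonicalDeriv_ofCoord_const (hφ : IsSmoothChart E φ)
    (hF : ∀ w, ∃ w', ∀ y ∈ φ.source, S.F y (ofCoord φ (fun _ ↦ w) y) = ofCoord φ (fun _ ↦ w') y)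
    (hP : ∀ w, ∃ w', ∀ y ∈ φ.source, S.P y (ofCoord φ (fun _ ↦ w) y) = ofCoord φ (fun _ ↦ w') y)
    {y : M} (hy : y ∈ φ.source) (u v : E') :
    S.canonicalDeriv (ofCoord φ fun _ ↦ v) (ofCoord φ fun _ ↦ u) y = 0 := by
  have hs := φ.open_source.mem_nhds hy
  have hpos : ∀ w, ∃ w', S.projPos (ofCoord φ fun _ ↦ w) =ᶠ[𝓝 y] ofCoord φ (fun _ ↦ w') := by
    intro w
    obtain ⟨w', hw'⟩ := hF w
    refine ⟨(2⁻¹ : ℝ) • (w + w'), Filter.eventually_of_mem hs fun x hx ↦ ?_⟩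
    simp only [projPos, Pi.smul_apply, Pi.add_apply, hw' x hx]
    exact ((map_smul _ _ _).trans (congrArg _ (map_add _ _ _))).symm
  have hneg : ∀ w, ∃ w', S.projNeg (ofCoord φ fun _ ↦ w) =ᶠ[𝓝 y] ofCoord φ (fun _ ↦ w') := by
    intro w
    obtain ⟨w', hw'⟩ := hF w
    refine ⟨(2⁻¹ : ℝ) • (w - w'), Filter.eventually_of_mem hs fun x hx ↦ ?_⟩
    simp only [projNeg, Pi.smul_apply, Pi.sub_apply, hw' x hx]
    exact ((map_smul _ _ _).trans (congrArg _ (map_sub _ _ _))).symm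
  have hap : ∀ {X : Π x : M, TangentSpace 𝓘(ℝ, E) x} {w}, X =ᶠ[𝓝 y] ofCoord φ (fun _ ↦ w) →
      ∃ w', S.applyP X =ᶠ[𝓝 y] ofCoord φ (fun _ ↦ w') := by
    intro X w hX
    obtain ⟨w', hw'⟩ := hP w
    refine ⟨w', ?_⟩
    filter_upwards [hX, hs] with x hx hxs
    rw [applyP, hx, hw' x hxs]
  have hbr : ∀ {X Y : Π x : M, TangentSpace 𝓘(ℝ, E) x} {w w'},
      X =ᶠ[𝓝 y] ofCoord φ (fun _ ↦ w) → Y =ᶠ[𝓝 y] ofCoord φ (fun _ ↦ w') →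
      mlieBracket 𝓘(ℝ, E) X Y y = 0 := by
    intro X Y w w' hX hY
    rw [hX.mlieBracket_vectorField_eq hY, hφ.mlieBracket_ofCoord hy (by fun_prop) (by fun_prop),
      ofCoord_congr (g := 0) (by simp), ofCoord_zero]
    rfl
  obtain ⟨_, hu⟩ := hpos u
  obtain ⟨_, hu'⟩ := hneg u
  obtain ⟨_, hv⟩ := hpos v
  obtain ⟨_, hv'⟩ := hneg v
  obtain ⟨_, hPv⟩ := hap hv
  obtain ⟨_, hPv'⟩ := hap hv'
  rw [canonicalDeriv_apply, hbr hu' hv, hbr hu hPv, hbr hu hv', hbr hu' hPv']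
  simp

/-- The canonical connection is the standard flat connection in coordinates in which `F` and `P` are
constant. -/
lemma canonicalConnection_ofCoord (hφ : IsSmoothChart E φ)
    (hF : ∀ w, ∃ w', ∀ y ∈ φ.source, S.F y (ofCoord φ (fun _ ↦ w) y) = ofCoord φ (fun _ ↦ w') y)
    (hP : ∀ w, ∃ w', ∀ y ∈ φ.source, S.P y (ofCoord φ (fun _ ↦ w) y) = ofCoord φ (fun _ ↦ w') y)
    {y : M} (hy : y ∈ φ.source) (u : E') {f : E' → E'} (hf : DifferentiableAt ℝ f (φ y)) :
    S.canonicalConnection (ofCoord φ f) y (ofCoord φ (fun _ ↦ u) y)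
      = ofCoord φ (fun z ↦ fderiv ℝ f z u) y := by
  obtain ⟨Γ, -, hΓ⟩ := hφ.exists_christoffel
    (fun hX hY ↦ S.contMDiffAt_canonicalConnection hX hY)
  -- On constant fields the derivative term is absent, so Γ is exactly the explicit formula, which
  -- vanishes there.
  have hΓ0 : ∀ u v, Γ (φ y) u v = 0 := by
    intro u v
    have hu := hφ.mdiffAt_ofCoord hy (f := fun _ ↦ u) (by fun_prop)
    have hv := hφ.mdiffAt_ofCoord hy (f := fun _ ↦ v) (by fun_prop)
    have h1 := hΓ y hy u (fun _ ↦ v) (by fun_prop)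
    rw [S.isCanonicalConnection_canonicalConnection.eq S.isCanonicalConnection_explicitConnection
      hv, S.explicitConnection_apply hu, canonicalDeriv_ofCoord_const hφ hF hP hy] at h1
    have h2 := (hφ.ofCoord_inj hy).1 ((congrFun (ofCoord_zero φ) _).trans h1)
    simpa using h2.symm
  rw [hΓ y hy u f hf]
  exact ofCoord_congr (by simp [hΓ0])

end Constant

theorem flat_of_hasStandardCoordinates (h : S.HasStandardCoordinates n) :
    S.canonicalConnection.torsion = 0 ∧ IsCurvatureFree S.canonicalConnection := by
  have key : ∀ x : M, ∃ φ : OpenPartialHomeomorph M (EuclideanSpace ℝ (Fin n ⊕ Fin n)),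
      x ∈ φ.source ∧ IsSmoothChart E φ ∧ ∀ y ∈ φ.source, ∀ u f, DifferentiableAt ℝ f (φ y) →
        S.canonicalConnection (ofCoord φ f) y (ofCoord φ (fun _ ↦ u) y)
          = ofCoord φ (fun z ↦ fderiv ℝ f z u) y := by
    intro x
    obtain ⟨φ, hx, hφ, hS⟩ := h x
    have hF := exists_map_ofCoord_const (A := S.F) (φ := φ)
      (Sum.elim (fun i ↦ EuclideanSpace.single (.inr i) 1)
        fun i ↦ EuclideanSpace.single (.inl i) 1) (by
        rintro y hy (i | i)
        · exact (hS y hy i).1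
        · exact (hS y hy i).2.1)
    have hP := exists_map_ofCoord_const (A := S.P) (φ := φ)
      (Sum.elim (fun i ↦ EuclideanSpace.single (.inl i) 1)
        fun i ↦ -EuclideanSpace.single (.inr i) 1) (by
        rintro y hy (i | i)
        · exact (hS y hy i).2.2.1
        · exact (hS y hy i).2.2.2.trans (map_neg _ _).symm)
    exact ⟨φ, hx, hφ.isSmoothChart, fun y hy u f hf ↦
      canonicalConnection_ofCoord hφ.isSmoothChart hF hP hy u hf⟩
  constructor
  · funext x
    obtain ⟨φ, hx, hφ, hc⟩ := key x
    ext u v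
    obtain ⟨u', hu'⟩ : ∃ u' : EuclideanSpace ℝ (Fin n ⊕ Fin n), u = ofCoord φ (fun _ ↦ u') x :=
      ⟨_, (hφ.eq_ofCoord_iff hx).2 rfl⟩
    obtain ⟨v', hv'⟩ : ∃ v' : EuclideanSpace ℝ (Fin n ⊕ Fin n), v = ofCoord φ (fun _ ↦ v') x :=
      ⟨_, (hφ.eq_ofCoord_iff hx).2 rfl⟩
    -- Torsion is tensorial, so it suffices to extend both vectors to constant coordinate fields.
    rw [hu', hv', torsion_christoffel (Γ := 0) (by simpa using hc) hφ hx,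
      ofCoord_congr (g := 0) (by simp), ofCoord_zero]
    rfl
  · intro X Y Z hX hY hZ x
    obtain ⟨φ, hx, hφ, hc⟩ := key x
    exact curvatureField_eq_zero_of_christoffel_eq_zero hφ hc hx (hX x) (hY x) (hZ x)

end AlmostBiparacomplex

end Integrability

end

theorem mainTheorem3 {E : Type*} [NormedAddCommGroup E] [NormedSpace ℝ E] [FiniteDimensional ℝ E]
    {M : Type*} [TopologicalSpace M] [T2Space M] [SecondCountableTopology M]
    [ChartedSpace E M] [IsManifold 𝓘(ℝ, E) ∞ M]
    (n : ℕ) (hn : Module.finrank ℝ E = 2 * n) (S : AlmostBiparacomplex E M) :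
    List.TFAE
      [S.canonicalConnection.torsion = 0 ∧ IsCurvatureFree S.canonicalConnection,
        S.HasStandardCoordinates n,
        (S.gStructure n hn).IsIntegrable] := by
  tfae_have 1 → 3 := fun h ↦ S.isIntegrable_of_flat hn h.1 h.2
  tfae_have 3 → 2 := fun h ↦ S.hasStandardCoordinates_of_isIntegrable h
  tfae_have 2 → 1 := fun h ↦ S.flat_of_hasStandardCoordinates h
  tfae_finish
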